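/- Let $M,\widetilde M\in\mathbb R^{n\times k}$ be matrices with orthonormal columns, and let $\theta_1\le\dots\le\theta_k$ in $[0,\pi/2]$ be the principal angles between their column spaces $\mathcal U$ and $\widetilde{\mathcal U}$: $\cos\theta_i$ is the maximum of $u^\top v$ over unit vectors $u\in\mathcal U$, $v\in\widetilde{\mathcal U}$ with $u\perp u_1,\dots,u_{i-1}$ and $v\perp v_1,\dots,v_{i-1}$, and $(u_i,v_i)$ is a pair where it is attained. Put $\Theta=\operatorname{diag}(\theta_1,\dots,\theta_k)$. Let the Grassmannian $\mathrm{Gr}(k,n)$ of $k$-dimensional subspaces of $\mathbb R^n$ carry its canonical Riemannian metric (a subspace is identified with its orthogonal projection matrix $P$, and $\langle X,Y\rangle=\tfrac12\operatorname{tr}(X^\top Y)$ for tangent vectors; this is the quotient of the Frobenius metric on matrices with orthonormal columns). Let $\Delta\in\mathbb R^{n\times k}$ be a matrix with orthonormal columns such that $$\widetilde M = M\cos\Theta+\Delta\sin\Theta .$$ (After replacing $M,\widetilde M$ by $MU,\widetilde MV$ for suitable orthogonal $k\times k$ matrices $U,V$, which does not change the subspaces, such a $\Delta$ always exists.) Put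 $$\gamma(t)=M\cos(t\Theta)+\Delta\sin(t\Theta),\qquad t\in[0,1].$$ Then $\gamma(t)$ has orthonormal columns for every $t\in[0,1]$, $\gamma(0)=M$, $\gamma(1)=\widetilde M$, and the column space of $\gamma(t)$, $t\in[0,1]$, is a shortest geodesic in $\mathrm{Gr}(k,n)$ from $\mathcal U$ to $\widetilde{\mathcal U}$: it is a geodesic, and no $C^1$ curve in $\mathrm{Gr}(k,n)$ joining the two subspaces is shorter. If all $\theta_i<\pi/2$, it is the only shortest geodesic on $[0,1]$ from $\mathcal U$ to $\widetilde{\mathcal U}$. Its Riemannian length, which also equals $\int_0^1\|\dot\gamma(t)\|_F\,dt$, is $$\Big(\sum_{i=1}^k\theta_i^2\Big)^{1/2},$$ the quantity that is called the projection distance of the two subspaces. -/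

import Mathlib

open Set Matrix
open scoped Matrix.Norms.Frobenius RealInnerProductSpace

noncomputable section

/-- The real Grassmannian `Gr(k, n)`: all `k`-dimensional linear subspaces of `ℝⁿ`. -/
def Gr (k n : ℕ) : Set (Submodule ℝ (EuclideanSpace ℝ (Fin n))) :=
  {W | Module.finrank ℝ W = k}

/-- The linear span of the columns of an `n × k` matrix, as a subspace of Euclidean space. -/
def colSpan {n k : ℕ} (Y : Matrix (Fin n) (Fin k) ℝ) :
    Submodule ℝ (EuclideanSpace ℝ (Fin n)) :=
  Submodule.span ℝ (Set.range fun j : Fin k => WithLp.toLp 2 (fun i : Fin n => Y i j))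

/-- `θ 0, θ 1, …` are the principal angles between `U` and `V`: there are successive pairs
`(u i, v i)` of unit vectors of `U` and `V`, the `i`-th one orthogonal to the earlier ones and with
the largest possible inner product, and `cos (θ i)` is this maximum. -/
def IsPrincipalAngles {n k : ℕ} (U V : Submodule ℝ (EuclideanSpace ℝ (Fin n)))
    (θ : Fin k → ℝ) : Prop :=
  Monotone θ ∧ (∀ i, θ i ∈ Icc 0 (Real.pi / 2)) ∧
  ∃ u v : Fin k → EuclideanSpace ℝ (Fin n), ∀ i,
    u i ∈ U ∧ v i ∈ V ∧ ‖u i‖ = 1 ∧ ‖v i‖ = 1 ∧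
    (∀ j < i, ⟪u i, u j⟫ = 0 ∧ ⟪v i, v j⟫ = 0) ∧
    ⟪u i, v i⟫ = Real.cos (θ i) ∧
    ∀ x ∈ U, ∀ y ∈ V, ‖x‖ = 1 → ‖y‖ = 1 →
      (∀ j < i, ⟪x, u j⟫ = 0 ∧ ⟪y, v j⟫ = 0) → ⟪x, y⟫ ≤ Real.cos (θ i)

/-! ### The Riemannian manifold `Gr(k, n)`

A subspace is identified with the matrix of the orthogonal projection onto it. This realises
`Gr(k, n)` as a compact smooth submanifold of the space of `n × n` matrices. -/

/-- The matrix of the orthogonal projection of `ℝⁿ` onto `W`. -/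
def projMatrix {n : ℕ} (W : Submodule ℝ (EuclideanSpace ℝ (Fin n))) :
    Matrix (Fin n) (Fin n) ℝ :=
  Matrix.toEuclideanLin.symm (W.starProjection : EuclideanSpace ℝ (Fin n) →ₗ[ℝ] _)

/-- The tangent space of `Gr(k, n)` at `W`: the symmetric matrices `X` with `P X + X P = X`, where
`P` is the projection onto `W`. These are the symmetric matrices that map `W` into its orthogonal
complement and conversely. -/
def grTangent {n : ℕ} (W : Submodule ℝ (EuclideanSpace ℝ (Fin n))) :
    Set (Matrix (Fin n) (Fin n) ℝ) :=
  {X | Xᵀ = X ∧ projMatrix W * X + X * projMatrix W = X}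

/-- The canonical Riemannian metric of `Gr(k, n)`, `⟨X, Y⟩ = tr (Xᵀ Y) / 2`. For the curve of
projections `Y Yᵀ`, where `Y` has orthonormal columns and `Yᵀ Y' = 0`, the squared speed is
the squared Frobenius norm of `Y'`; so this is the quotient of the Frobenius metric on the
matrices with orthonormal columns. -/
def grMetric {n : ℕ} (X Y : Matrix (Fin n) (Fin n) ℝ) : ℝ :=
  (Xᵀ * Y).trace / 2

/-- The velocity at time `t` of a curve `c : [0, 1] → Gr(k, n)` (one-sided at the ends). -/
def grVelocity {n : ℕ} (c : ℝ → Submodule ℝ (EuclideanSpace ℝ (Fin n))) (t : ℝ) :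
    Matrix (Fin n) (Fin n) ℝ :=
  derivWithin (fun s => projMatrix (c s)) (Icc 0 1) t

/-- `c` restricts to a curve `[0, 1] → Gr(k, n)` of class `C^r`. -/
def IsGrCurve {n : ℕ} (k r : ℕ) (c : ℝ → Submodule ℝ (EuclideanSpace ℝ (Fin n))) : Prop :=
  (∀ t ∈ Icc (0 : ℝ) 1, c t ∈ Gr k n) ∧
    ContDiffOn ℝ r (fun t => projMatrix (c t)) (Icc 0 1)

/-- The Riemannian length of a curve `c : [0, 1] → Gr(k, n)`. -/
def grLength {n : ℕ} (c : ℝ → Submodule ℝ (EuclideanSpace ℝ (Fin n))) : ℝ :=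
  ∫ t in (0 : ℝ)..1, Real.sqrt (grMetric (grVelocity c t) (grVelocity c t))

/-- `c : [0, 1] → Gr(k, n)` is a geodesic: its covariant acceleration vanishes, that is, the
acceleration in the ambient Euclidean space of matrices is everywhere orthogonal to the tangent
space (the Levi-Civita connection of a submanifold is the tangential part of the derivative). -/
def IsGrGeodesic {n : ℕ} (k : ℕ) (c : ℝ → Submodule ℝ (EuclideanSpace ℝ (Fin n))) : Prop :=
  IsGrCurve k 2 c ∧
    ∀ t ∈ Icc (0 : ℝ) 1, ∀ X ∈ grTangent (c t),
      grMetric (derivWithin (grVelocity c) (Icc 0 1) t) X = 0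

/-- `c : [0, 1] → Gr(k, n)` is a shortest geodesic from `U` to `V`: a geodesic that joins `U`
to `V` and is no longer than any other `C¹` curve in `Gr(k, n)` that joins them. -/
def IsShortestGrGeodesic {n : ℕ} (k : ℕ) (U V : Submodule ℝ (EuclideanSpace ℝ (Fin n)))
    (c : ℝ → Submodule ℝ (EuclideanSpace ℝ (Fin n))) : Prop :=
  IsGrGeodesic k c ∧ c 0 = U ∧ c 1 = V ∧
    ∀ d : ℝ → Submodule ℝ (EuclideanSpace ℝ (Fin n)),
      IsGrCurve k 1 d → d 0 = U → d 1 = V → grLength c ≤ grLength d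

/-- The matrix curve `γ(t) = M cos(tΘ) + Δ sin(tΘ)`, where `Θ = diag(θ)`. -/
def modeCurve {n k : ℕ} (M Δ : Matrix (Fin n) (Fin k) ℝ) (θ : Fin k → ℝ) (t : ℝ) :
    Matrix (Fin n) (Fin k) ℝ :=
  M * Matrix.diagonal (fun i => Real.cos (t * θ i)) +
    Δ * Matrix.diagonal (fun i => Real.sin (t * θ i))

end

/-!
# Shortest geodesics of the Grassmannian

Let `γ(t) = M cos(tΘ) + Δ sin(tΘ)`. Two facts about principal angles make this curve horizontal:
the matrix of inner products of the principal vectors is `diag (cos θᵢ)`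
(`IsPrincipalAngles.exists_adapted`), and hence `Mᵀ Δ sin Θ = 0`
(`transpose_mul_mul_diagonal_sin`). So `γᵀ γ = 1`, `γᵀ γ' = 0`, `γ'ᵀ γ' = Θ²` and `γ'' = -γ Θ²`, from
which the geodesic equation and the length are read off.

That no curve is shorter follows from a relaxation of the variational problem. A `C¹` curve from
`𝓤` to `𝓤'` in the Grassmannian has a horizontal lift `Y` that starts at `M`
(`IsGrCurve.exists_horizontal_lift`), and the Riemannian speed of the curve is `‖Y'‖`. The columns
`yᵢ` of `Y` are curves on the unit sphere, and completing a square (`sphere_energy_identity`) gives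
`∫ ‖yᵢ'‖² = θᵢ² + 2 (θᵢ / sin θᵢ) (cos θᵢ - ⟪yᵢ(0), yᵢ(1)⟫) + ∫ ‖yᵢ' - Fᵢ(t, yᵢ)‖²`,
where `Fᵢ` is a vector field, affine in `y`, along which the great circle arc of angle `θᵢ` from
`yᵢ(0)` moves. The columns of `Y(1)` are some orthonormal basis of `𝓤'`, but since
`Mᵀ M' = diag (cos θᵢ)`, one has
`⟪yᵢ(0), yᵢ(1)⟫ = cos θᵢ ⟪M'ᵢ, yᵢ(1)⟫ ≤ cos θᵢ`. So the energy is at least `∑ θᵢ²`, and the same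
inequality with a change of parameter gives the bound for the length
(`IsGrCurve.sqrt_sum_sq_le_grLength`).

A shortest geodesic has constant speed, so its energy is exactly `∑ θᵢ²` and all nonnegative terms
vanish: if all `θᵢ < π / 2`, then `yᵢ(1) = M'ᵢ`, and `yᵢ` solves the differential equation
`y' = Fᵢ(t, y)`, which determines it (`IsGrGeodesic.eq_of_grLength_le`).
-/

/-! ### Linear differential equations on `[0, 1]` -/

section LinearODE

variable {E : Type*} [NormedAddCommGroup E] [NormedSpace ℝ E]

/-- A linear differential equation `Y' = A(t) Y` with continuous coefficients has a solution on the
whole of `[0, 1]`. In the variable `z = e^{-ct} Y` the integral equation is a contraction as soon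
as `c ≥ 2 sup ‖A‖`. -/
theorem exists_hasDerivWithinAt_linear [CompleteSpace E] {A : ℝ → E →L[ℝ] E}
    (hA : ContinuousOn A (Icc 0 1)) (x₀ : E) :
    ∃ Y : ℝ → E, Y 0 = x₀ ∧ ∀ t ∈ Icc (0 : ℝ) 1, HasDerivWithinAt Y (A t (Y t)) (Icc 0 1) t := by
  have h01 : (0 : ℝ) ≤ 1 := zero_le_one
  set B : ℝ → E →L[ℝ] E := IccExtend h01 ((Icc (0 : ℝ) 1).domRestrict A) with hB
  have hBc : Continuous B := (continuousOn_iff_continuous_domRestrict.1 hA).Icc_extend'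
  have hBA : ∀ t ∈ Icc (0 : ℝ) 1, B t = A t := fun t ht => by
    rw [hB, IccExtend_of_mem _ _ ht]; rfl
  obtain ⟨K, hK0, hK⟩ : ∃ K : ℝ, 0 < K ∧ ∀ t ∈ Icc (0 : ℝ) 1, ‖B t‖ ≤ K := by
    obtain ⟨K, hK⟩ := isCompact_Icc.exists_bound_of_continuousOn hBc.continuousOn
    exact ⟨max K 1, lt_max_of_lt_right one_pos, fun t ht => (hK t ht).trans (le_max_left _ _)⟩
  let ext : C(Icc (0 : ℝ) 1, E) → ℝ → E := fun z => IccExtend h01 z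
  have hext : ∀ z, Continuous (ext z) := fun z => z.continuous.Icc_extend'
  let g : C(Icc (0 : ℝ) 1, E) → ℝ → E := fun z s => Real.exp (2 * K * s) • B s (ext z s)
  have hg : ∀ z, Continuous (g z) := fun z =>
    (Real.continuous_exp.comp (by fun_prop)).smul (hBc.clm_apply (hext z))
  let F : C(Icc (0 : ℝ) 1, E) → ℝ → E := fun z t => x₀ + ∫ s in (0 : ℝ)..t, g z s
  have hF : ∀ z t, HasDerivAt (F z) (g z t) t := fun z t =>
    (intervalIntegral.integral_hasDerivAt_right ((hg z).intervalIntegrable _ _)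
      ((hg z).stronglyMeasurableAtFilter _ _) (hg z).continuousAt).const_add _
  have hFc : ∀ z, Continuous (F z) := fun z =>
    continuous_iff_continuousAt.2 fun t => (hF z t).continuousAt
  let T : C(Icc (0 : ℝ) 1, E) → C(Icc (0 : ℝ) 1, E) := fun z =>
    ⟨fun t => Real.exp (-(2 * K * t)) • F z t,
      (Real.continuous_exp.comp (by fun_prop)).smul ((hFc z).comp continuous_subtype_val)⟩
  have hT : ContractingWith (1 / 2) T := by
    refine ⟨by norm_num [← NNReal.coe_lt_coe], LipschitzWith.of_dist_le_mul fun z w => ?_⟩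
    refine (ContinuousMap.dist_le (by positivity)).2 fun t => ?_
    have ht := t.2
    have hd : ∀ s ∈ Icc (0 : ℝ) 1,
        ‖g z s - g w s‖ ≤ Real.exp (2 * K * s) * (K * dist z w) := fun s hs => by
      simp only [g, ext]
      rw [← smul_sub, ← map_sub, norm_smul, Real.norm_eq_abs, abs_of_pos (Real.exp_pos _)]
      refine mul_le_mul_of_nonneg_left ?_ (Real.exp_pos _).le
      refine (ContinuousLinearMap.le_opNorm _ _).trans ?_
      refine mul_le_mul (hK s hs) ?_ (norm_nonneg _) hK0.le
      rw [IccExtend_of_mem _ _ hs, IccExtend_of_mem _ _ hs, ← dist_eq_norm]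
      exact ContinuousMap.dist_apply_le_dist _
    have hint : ‖F z t - F w t‖ ≤ (Real.exp (2 * K * t) - 1) / (2 * K) * (K * dist z w) := by
      have e1 : F z t - F w t = ∫ s in (0 : ℝ)..t, (g z s - g w s) := by
        simp only [F]
        rw [intervalIntegral.integral_sub ((hg z).intervalIntegrable _ _)
          ((hg w).intervalIntegrable _ _)]
        abel
      have e2 : ∫ s in (0 : ℝ)..t, Real.exp (2 * K * s) * (K * dist z w)
          = (Real.exp (2 * K * t) - 1) / (2 * K) * (K * dist z w) := by
        rw [intervalIntegral.integral_mul_const,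
          intervalIntegral.integral_comp_mul_left (fun x => Real.exp x) (by positivity)]
        simp [div_eq_inv_mul]
      rw [e1, ← e2]
      refine intervalIntegral.norm_integral_le_of_norm_le ht.1 ?_ ?_
      · exact Filter.Eventually.of_forall fun s hs => hd s ⟨hs.1.le, hs.2.trans ht.2⟩
      · exact (Continuous.intervalIntegrable (by fun_prop) _ _)
    calc dist (T z t) (T w t) = Real.exp (-(2 * K * t)) * ‖F z t - F w t‖ := by
          simp only [T, ContinuousMap.coe_mk]
          rw [dist_eq_norm, ← smul_sub, norm_smul, Real.norm_eq_abs, abs_of_pos (Real.exp_pos _)]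
      _ ≤ Real.exp (-(2 * K * t)) * ((Real.exp (2 * K * t) - 1) / (2 * K) * (K * dist z w)) :=
          mul_le_mul_of_nonneg_left hint (Real.exp_pos _).le
      _ = (1 - Real.exp (-(2 * K * t))) / 2 * dist z w := by
          rw [Real.exp_neg]; field_simp
      _ ≤ ((1 / 2 : NNReal) : ℝ) * dist z w := by
          refine mul_le_mul_of_nonneg_right ?_ dist_nonneg
          have := Real.exp_pos (-(2 * K * t))
          push_cast; linarith
  have hfix := hT.fixedPoint_isFixedPt
  set z := hT.fixedPoint
  refine ⟨F z, by simp [F], fun t ht => ?_⟩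
  have hzt : ext z t = Real.exp (-(2 * K * t)) • F z t := by
    have := congrArg (fun f : C(Icc (0 : ℝ) 1, E) => f ⟨t, ht⟩) hfix.eq
    simp only [ext]
    rw [IccExtend_of_mem _ _ ht]
    exact this.symm
  have := (hF z t).hasDerivWithinAt (s := Icc 0 1)
  rwa [show g z t = A t (F z t) by
    simp only [g]
    rw [hzt, map_smul, smul_smul, ← Real.exp_add, hBA t ht]; simp] at this

/-- The zero solution is the only solution of a linear equation `Z' = A(t) Z` with `Z 0 = 0`. -/
theorem eq_zero_of_hasDerivWithinAt_linear {A : ℝ → E →L[ℝ] E}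
    (hA : ContinuousOn A (Icc 0 1)) {Z : ℝ → E} (h0 : Z 0 = 0)
    (hZ : ∀ t ∈ Icc (0 : ℝ) 1, HasDerivWithinAt Z (A t (Z t)) (Icc 0 1) t) :
    ∀ t ∈ Icc (0 : ℝ) 1, Z t = 0 := by
  obtain ⟨K, hK⟩ := isCompact_Icc.exists_bound_of_continuousOn hA
  refine eq_zero_of_abs_deriv_le_mul_abs_self_of_eq_zero_right (K := K)
    (f' := fun t => A t (Z t)) (fun t ht => (hZ t ht).continuousWithinAt) (fun t ht => ?_) h0
    (fun t ht => ?_)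
  · exact ((hZ t (Ico_subset_Icc_self ht)).mono_of_mem_nhdsWithin
      (Icc_mem_nhdsGE_of_mem ht))
  · exact ((A t).le_opNorm _).trans
      (mul_le_mul_of_nonneg_right (hK t (Ico_subset_Icc_self ht)) (norm_nonneg _))

end LinearODE

/-! ### The energy of curves on the unit sphere -/

section Sphere

variable {E : Type*} [NormedAddCommGroup E] [InnerProductSpace ℝ E]

/-- The affine vector field along which the great circle arc from `a` to `b`, traversed with constant
speed, moves at time `s ∈ [0, 1]`: if `a` and `b` are unit vectors at angle `θ`, the velocity of the
arc, when it passes through `y` at time `s`, is `arcField θ a b s y`. For `θ = 0` the division by `sin (θ / 2) = 0` is harmless, since the field is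
then zero. -/
noncomputable def arcField (θ : ℝ) (a b : E) (s : ℝ) (y : E) : E :=
  (θ / Real.cos (θ * (s - 1 / 2))) • ((2 * Real.sin (θ / 2))⁻¹ • (b - a)) -
    (θ * Real.tan (θ * (s - 1 / 2))) • y

theorem cos_mul_sub_half_pos {θ s : ℝ} (hθ : θ ∈ Icc 0 (Real.pi / 2)) (hs : s ∈ Icc (0 : ℝ) 1) :
    0 < Real.cos (θ * (s - 1 / 2)) := by
  have hpi := Real.pi_pos
  apply Real.cos_pos_of_mem_Ioo
  constructor <;> nlinarith [hθ.1, hθ.2, hs.1, hs.2, mul_nonneg hθ.1 hs.1,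
    mul_nonneg hθ.1 (sub_nonneg.2 hs.2)]

theorem continuousOn_arcField {θ : ℝ} (hθ : θ ∈ Icc 0 (Real.pi / 2)) (a b : E) {σ : ℝ → ℝ}
    {y : ℝ → E} (hσ : ContinuousOn σ (Icc 0 1)) (hσI : ∀ t ∈ Icc (0 : ℝ) 1, σ t ∈ Icc (0 : ℝ) 1)
    (hy : ContinuousOn y (Icc 0 1)) :
    ContinuousOn (fun t => arcField θ a b (σ t) (y t)) (Icc 0 1) := by
  have hc : ∀ t ∈ Icc (0 : ℝ) 1, Real.cos (θ * (σ t - 1 / 2)) ≠ 0 := fun t ht =>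
    (cos_mul_sub_half_pos hθ (hσI t ht)).ne'
  have hl : ContinuousOn (fun t => θ * (σ t - 1 / 2)) (Icc 0 1) := by fun_prop
  have hcos := Real.continuous_cos.comp_continuousOn hl
  have hsin := Real.continuous_sin.comp_continuousOn hl
  unfold arcField
  simp only [Real.tan_eq_sin_div_cos]
  exact ((continuousOn_const.div hcos hc).smul continuousOn_const).sub
    ((continuousOn_const.mul (hsin.div hcos hc)).smul hy)

/-- The weighted energy of a curve `y` on the unit sphere, written as the squared angle `θ²`, plus
a term that depends only on the end points and vanishes when they are at angle `θ`, plus the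
integral of a square. Here `σ` is a change of parameter of `[0, 1]` with speed `w`. The square
is completed with `arcField`; the remaining terms form the derivative of
`2 ⟪y, q⟫ - (1 + ‖n‖²) p`, where `arcField` is `q - p y`, with
`p = θ tan (θ (σ - 1 / 2))`, `q = θ n / cos (θ (σ - 1 / 2))` and
`n = (y 1 - y 0) / (2 sin (θ / 2))`. For `θ = 0` the divisions by zero give the correct value `0`. -/
theorem sphere_energy_identity {y y' : ℝ → E} {σ w : ℝ → ℝ} {θ : ℝ}
    (hθ : θ ∈ Icc 0 (Real.pi / 2))
    (hy : ∀ t ∈ Icc (0 : ℝ) 1, HasDerivWithinAt y (y' t) (Icc 0 1) t)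
    (hy' : ContinuousOn y' (Icc 0 1)) (hn : ∀ t ∈ Icc (0 : ℝ) 1, ‖y t‖ = 1)
    (hσ : ∀ t ∈ Icc (0 : ℝ) 1, HasDerivWithinAt σ (w t) (Icc 0 1) t)
    (hσI : ∀ t ∈ Icc (0 : ℝ) 1, σ t ∈ Icc (0 : ℝ) 1)
    (hw : ContinuousOn w (Icc 0 1)) (hw0 : ∀ t ∈ Icc (0 : ℝ) 1, 0 < w t)
    (hσ0 : σ 0 = 0) (hσ1 : σ 1 = 1) :
    ∫ t in (0 : ℝ)..1, ‖y' t‖ ^ 2 / w t =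
      θ ^ 2 + 2 * θ / Real.sin θ * (Real.cos θ - ⟪y 0, y 1⟫) +
        ∫ t in (0 : ℝ)..1, ‖y' t - w t • arcField θ (y 0) (y 1) (σ t) (y t)‖ ^ 2 / w t := by
  obtain ⟨n, hndef⟩ : ∃ n : E, n = (2 * Real.sin (θ / 2))⁻¹ • (y 1 - y 0) := ⟨_, rfl⟩
  have hyc : ContinuousOn y (Icc 0 1) := fun t ht => (hy t ht).continuousWithinAt
  have hσc : ContinuousOn σ (Icc 0 1) := fun t ht => (hσ t ht).continuousWithinAt
  have hc : ∀ t ∈ Icc (0 : ℝ) 1, 0 < Real.cos (θ * (σ t - 1 / 2)) := fun t ht =>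
    cos_mul_sub_half_pos hθ (hσI t ht)
  have horth : ∀ t ∈ Icc (0 : ℝ) 1, ⟪y t, y' t⟫ = 0 := fun t ht => by
    have h1 := ((hy t ht).inner ℝ (hy t ht)).congr_of_mem
      (f₁ := fun _ => (1 : ℝ)) (fun s hs => by rw [real_inner_self_eq_norm_sq, hn s hs]; norm_num) ht
    have h2 := (uniqueDiffOn_Icc_zero_one t ht).eq_deriv _ h1 (hasDerivWithinAt_const t _ (1 : ℝ))
    rw [real_inner_comm (y t) (y' t)] at h2
    linarith
  have hcont := continuousOn_arcField hθ (y 0) (y 1) hσc hσI hyc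
  have hI1 : ContinuousOn (fun t => ‖y' t‖ ^ 2 / w t) (Icc 0 1) :=
    (hy'.norm.pow 2).div hw fun t ht => (hw0 t ht).ne'
  have hI2 : ContinuousOn
      (fun t => ‖y' t - w t • arcField θ (y 0) (y 1) (σ t) (y t)‖ ^ 2 / w t) (Icc 0 1) :=
    ((hy'.sub (hw.smul hcont)).norm.pow 2).div hw fun t ht => (hw0 t ht).ne'
  let G : ℝ → ℝ := fun t =>
    2 * (⟪y t, n⟫ * (θ / Real.cos (θ * (σ t - 1 / 2)))) -
      (1 + ‖n‖ ^ 2) * (θ * Real.tan (θ * (σ t - 1 / 2))) + θ ^ 2 * σ t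
  have hG : ∀ t ∈ Icc (0 : ℝ) 1, HasDerivWithinAt G (‖y' t‖ ^ 2 / w t -
      ‖y' t - w t • arcField θ (y 0) (y 1) (σ t) (y t)‖ ^ 2 / w t) (Icc 0 1) t := fun t ht => by
    have hct := (hc t ht).ne'
    have hwt := (hw0 t ht).ne'
    have hl : HasDerivWithinAt (fun t => θ * (σ t - 1 / 2)) (θ * w t) (Icc 0 1) t :=
      ((hσ t ht).sub_const _).const_mul θ
    have hcos := hl.cos
    have htan := (Real.hasDerivAt_tan hct).comp_hasDerivWithinAt t hl
    have hin := (hy t ht).inner ℝ (hasDerivWithinAt_const t (Icc 0 1) n)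
    have hmain := (((hin.mul ((hasDerivWithinAt_const t (Icc 0 1) θ).div hcos hct)).const_mul 2).sub
      ((htan.const_mul θ).const_mul (1 + ‖n‖ ^ 2))).add ((hσ t ht).const_mul (θ ^ 2))
    refine hmain.congr_deriv ?_
    have hexp : ‖y' t - w t • arcField θ (y 0) (y 1) (σ t) (y t)‖ ^ 2 =
        ‖y' t‖ ^ 2 - 2 * w t * (θ / Real.cos (θ * (σ t - 1 / 2)) * ⟪y' t, n⟫) +
        w t ^ 2 * ((θ / Real.cos (θ * (σ t - 1 / 2))) ^ 2 * ‖n‖ ^ 2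
          - 2 * (θ / Real.cos (θ * (σ t - 1 / 2))) * (θ * Real.tan (θ * (σ t - 1 / 2))) * ⟪y t, n⟫
          + (θ * Real.tan (θ * (σ t - 1 / 2))) ^ 2) := by
      unfold arcField
      rw [← hndef, norm_sub_sq_real, inner_smul_right, norm_smul, mul_pow, norm_sub_sq_real,
        inner_sub_right, inner_smul_right, inner_smul_right, inner_smul_left, inner_smul_right,
        norm_smul, norm_smul, real_inner_comm (y t) (y' t), horth t ht, real_inner_comm (y t) n,
        hn t ht]
      simp only [Real.norm_eq_abs, mul_pow, sq_abs, conj_trivial]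
      ring
    rw [hexp]
    simp only [inner_zero_right, zero_add, Pi.div_apply, Real.tan_eq_sin_div_cos, zero_mul]
    have hsc := Real.sin_sq_add_cos_sq (θ * (σ t - 1 / 2))
    set S := Real.sin (θ * (σ t - 1 / 2))
    set C := Real.cos (θ * (σ t - 1 / 2))
    field_simp
    have hS : S ^ 2 = 1 - C ^ 2 := by linarith
    ring_nf
    simp only [hS]
    ring
  have hftc := intervalIntegral.integral_eq_sub_of_hasDerivAt_of_le zero_le_one
    (fun t ht => (hG t ht).continuousWithinAt)
    (fun t ht => (hG t (Ioo_subset_Icc_self ht)).hasDerivAt (Icc_mem_nhds ht.1 ht.2))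
    ((hI1.sub hI2).intervalIntegrable_of_Icc zero_le_one)
  rw [intervalIntegral.integral_sub (hI1.intervalIntegrable_of_Icc zero_le_one)
    (hI2.intervalIntegrable_of_Icc zero_le_one)] at hftc
  have hGend : G 1 - G 0 = θ ^ 2 + 2 * θ / Real.sin θ * (Real.cos θ - ⟪y 0, y 1⟫) := by
    rcases hθ.1.eq_or_lt with h0 | hpos
    · simp [G, ← h0]
    have hpi := Real.pi_pos
    have hs : 0 < Real.sin (θ / 2) :=
      Real.sin_pos_of_pos_of_lt_pi (by linarith) (by linarith [hθ.2])
    have hch : 0 < Real.cos (θ / 2) :=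
      Real.cos_pos_of_mem_Ioo ⟨by linarith, by linarith [hθ.2]⟩
    have h2 : Real.sin θ = 2 * Real.sin (θ / 2) * Real.cos (θ / 2) := by
      rw [← Real.sin_two_mul]; congr 1; ring
    have h3 : Real.cos θ = 1 - 2 * Real.sin (θ / 2) ^ 2 := by
      rw [← Real.cos_two_mul_eq_one_sub]; congr 1; ring
    have n0 := hn 0 (by simp)
    have n1 := hn 1 (by simp)
    have hi1 : ⟪y 1, n⟫ - ⟪y 0, n⟫ = (2 * Real.sin (θ / 2))⁻¹ * (2 - 2 * ⟪y 0, y 1⟫) := by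
      rw [← inner_sub_left, hndef, inner_smul_right, real_inner_self_eq_norm_sq, norm_sub_sq_real,
        n0, n1, real_inner_comm]
      ring
    have hnn : ‖n‖ ^ 2 = ((2 * Real.sin (θ / 2))⁻¹) ^ 2 * (2 - 2 * ⟪y 0, y 1⟫) := by
      rw [hndef, norm_smul, mul_pow, norm_sub_sq_real, n0, n1, real_inner_comm,
        Real.norm_eq_abs, sq_abs]
      ring
    have e1 : θ * (1 - 1 / 2) = θ / 2 := by ring
    have e0 : θ * (0 - 1 / 2) = -(θ / 2) := by ring
    have hGe : G 1 - G 0 = 2 * (⟪y 1, n⟫ - ⟪y 0, n⟫) * (θ / Real.cos (θ / 2)) -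
        2 * (1 + ‖n‖ ^ 2) * (θ * Real.tan (θ / 2)) + θ ^ 2 := by
      simp only [G, hσ0, hσ1, e1, e0, Real.cos_neg, Real.tan_neg]
      ring
    rw [hGe, hi1, hnn, h2, h3, Real.tan_eq_sin_div_cos]
    field_simp
    ring
  linarith

end Sphere

/-! ### Calculus of matrix-valued functions -/

section MatrixCalculus

variable {l m n : Type*} [Fintype l] [Fintype m] [Fintype n]

/-- Matrix multiplication as a continuous bilinear map for the Frobenius norms. -/
noncomputable def matrixMulCLM (l m n : Type*) [Fintype l] [Fintype m] [Fintype n] :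
    Matrix l m ℝ →L[ℝ] Matrix m n ℝ →L[ℝ] Matrix l n ℝ :=
  (mulLinearMap ℝ : Matrix l m ℝ →ₗ[ℝ] Matrix m n ℝ →ₗ[ℝ] Matrix l n ℝ).mkContinuous₂ 1
    fun A B => by simpa using Matrix.frobenius_norm_mul A B

/-- Transposition as a continuous linear map. -/
noncomputable def matrixTransposeCLM (m n : Type*) [Fintype m] [Fintype n] :
    Matrix m n ℝ →L[ℝ] Matrix n m ℝ :=
  (Matrix.transposeLinearEquiv m n ℝ ℝ).toLinearMap.mkContinuous 1
    fun A => by simp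

theorem HasDerivWithinAt.matrixMul {A : ℝ → Matrix l m ℝ} {B : ℝ → Matrix m n ℝ}
    {A' : Matrix l m ℝ} {B' : Matrix m n ℝ} {s : Set ℝ} {t : ℝ}
    (hA : HasDerivWithinAt A A' s t) (hB : HasDerivWithinAt B B' s t) :
    HasDerivWithinAt (fun t => A t * B t) (A t * B' + A' * B t) s t :=
  (matrixMulCLM l m n).hasDerivWithinAt_of_bilinear hA hB

theorem HasDerivWithinAt.matrixTranspose {A : ℝ → Matrix m n ℝ} {A' : Matrix m n ℝ} {s : Set ℝ}
    {t : ℝ} (hA : HasDerivWithinAt A A' s t) : HasDerivWithinAt (fun t => (A t)ᵀ) A'ᵀ s t :=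
  (matrixTransposeCLM m n).hasFDerivAt.comp_hasDerivWithinAt t hA

theorem hasDerivAt_diagonal [DecidableEq n] {f : ℝ → n → ℝ} {f' : n → ℝ} {t : ℝ}
    (hf : ∀ i, HasDerivAt (fun s => f s i) (f' i) t) :
    HasDerivAt (fun s => Matrix.diagonal (f s)) (Matrix.diagonal f') t := by
  let D : (n → ℝ) →L[ℝ] Matrix n n ℝ := LinearMap.toContinuousLinearMap
    (Matrix.diagonalLinearMap n ℝ ℝ)
  exact D.hasFDerivAt.comp_hasDerivAt t (hasDerivAt_pi.2 hf)

end MatrixCalculus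

/-! ### Columns, column spaces and projections -/

section Columns

variable {n k : ℕ}

/-- The `i`-th column of a matrix as a vector of Euclidean space. -/
def colVec (Y : Matrix (Fin n) (Fin k) ℝ) (i : Fin k) : EuclideanSpace ℝ (Fin n) :=
  WithLp.toLp 2 fun r => Y r i

theorem inner_colVec (Y Z : Matrix (Fin n) (Fin k) ℝ) (i j : Fin k) :
    ⟪colVec Y i, colVec Z j⟫ = (Yᵀ * Z) i j := by
  simp [colVec, PiLp.inner_apply, Matrix.mul_apply, mul_comm]

theorem sum_norm_colVec_sq (Y : Matrix (Fin n) (Fin k) ℝ) :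
    ∑ i, ‖colVec Y i‖ ^ 2 = (Yᵀ * Y).trace := by
  simp only [← real_inner_self_eq_norm_sq, inner_colVec]
  rfl

theorem norm_sq_eq_trace (Y : Matrix (Fin n) (Fin k) ℝ) : ‖Y‖ ^ 2 = (Yᵀ * Y).trace := by
  have h : (0 : ℝ) ≤ ∑ i, ∑ j, ‖Y i j‖ ^ (2 : ℝ) :=
    Finset.sum_nonneg fun i _ => Finset.sum_nonneg fun j _ => by positivity
  rw [Matrix.frobenius_norm_def, ← Real.sqrt_eq_rpow, Real.sq_sqrt h, Finset.sum_comm]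
  simp [Matrix.trace, Matrix.mul_apply, sq]

theorem norm_colVec_eq_one {Y : Matrix (Fin n) (Fin k) ℝ} (hY : Yᵀ * Y = 1) (i : Fin k) :
    ‖colVec Y i‖ = 1 := by
  have : ‖colVec Y i‖ ^ 2 = 1 := by rw [← real_inner_self_eq_norm_sq, inner_colVec, hY]; simp
  nlinarith [norm_nonneg (colVec Y i)]

theorem orthonormal_colVec {Y : Matrix (Fin n) (Fin k) ℝ} (hY : Yᵀ * Y = 1) :
    Orthonormal ℝ (colVec Y) := by
  rw [orthonormal_iff_ite]
  intro i j
  rw [inner_colVec, hY, Matrix.one_apply]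

/-- Passing to a column is continuous and linear. -/
noncomputable def colVecCLM (i : Fin k) :
    Matrix (Fin n) (Fin k) ℝ →L[ℝ] EuclideanSpace ℝ (Fin n) :=
  LinearMap.toContinuousLinearMap
    { toFun := fun Y => colVec Y i
      map_add' := fun _ _ => rfl
      map_smul' := fun _ _ => rfl }

theorem HasDerivWithinAt.colVec {Y : ℝ → Matrix (Fin n) (Fin k) ℝ}
    {Y' : Matrix (Fin n) (Fin k) ℝ} {s : Set ℝ} {t : ℝ} (hY : HasDerivWithinAt Y Y' s t)
    (i : Fin k) : HasDerivWithinAt (fun t => colVec (Y t) i) (colVec Y' i) s t :=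
  (colVecCLM i).hasFDerivAt.comp_hasDerivWithinAt t hY

theorem eq_of_colVec_eq {Y Z : Matrix (Fin n) (Fin k) ℝ} (h : ∀ i, colVec Y i = colVec Z i) :
    Y = Z := by
  ext r i
  exact congrArg (fun x : EuclideanSpace ℝ (Fin n) => x r) (h i)

theorem mem_colSpan_iff {Y : Matrix (Fin n) (Fin k) ℝ} {x : EuclideanSpace ℝ (Fin n)} :
    x ∈ colSpan Y ↔ ∃ a : Fin k → ℝ, WithLp.toLp 2 (Y *ᵥ a) = x := by
  unfold colSpan
  rw [Submodule.mem_span_range_iff_exists_fun]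
  refine exists_congr fun a => ?_
  have : ∑ i, a i • (WithLp.toLp 2 fun r => Y r i : EuclideanSpace ℝ (Fin n)) =
      WithLp.toLp 2 (Y *ᵥ a) := by
    ext r
    simp [Matrix.mulVec, dotProduct, mul_comm]
  rw [this]

theorem colVec_mem_colSpan (Y : Matrix (Fin n) (Fin k) ℝ) (i : Fin k) :
    colVec Y i ∈ colSpan Y :=
  Submodule.subset_span ⟨i, rfl⟩

theorem colSpan_mul_le {m : ℕ} (Y : Matrix (Fin n) (Fin k) ℝ) (A : Matrix (Fin k) (Fin m) ℝ) :
    colSpan (Y * A) ≤ colSpan Y := by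
  intro x hx
  obtain ⟨a, rfl⟩ := mem_colSpan_iff.1 hx
  exact mem_colSpan_iff.2 ⟨A *ᵥ a, by rw [Matrix.mulVec_mulVec]⟩

theorem finrank_colSpan {Y : Matrix (Fin n) (Fin k) ℝ} (hY : Yᵀ * Y = 1) :
    Module.finrank ℝ (colSpan Y) = k := by
  have := finrank_span_eq_card (orthonormal_colVec hY).linearIndependent
  rwa [Fintype.card_fin] at this

theorem projMatrix_colSpan {Y : Matrix (Fin n) (Fin k) ℝ} (hY : Yᵀ * Y = 1) :
    projMatrix (colSpan Y) = Y * Yᵀ := by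
  unfold projMatrix
  rw [LinearEquiv.symm_apply_eq]
  ext1 x
  refine Submodule.eq_starProjection_of_mem_of_inner_eq_zero ?_ fun w hw => ?_
  · rw [Matrix.toLpLin_apply, ← Matrix.mulVec_mulVec]
    exact mem_colSpan_iff.2 ⟨_, rfl⟩
  · obtain ⟨a, rfl⟩ := mem_colSpan_iff.1 hw
    rw [inner_sub_left, Matrix.toLpLin_apply]
    simp only [EuclideanSpace.inner_eq_star_dotProduct, star_trivial]
    rw [← Matrix.mulVec_mulVec, dotProduct_comm, dotProduct_comm (Y *ᵥ a),
      Matrix.dotProduct_mulVec, Matrix.dotProduct_mulVec, ← Matrix.mulVec_transpose,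
      ← Matrix.mulVec_transpose, Matrix.mulVec_mulVec, hY, Matrix.one_mulVec, sub_self]

/-- Every subspace of dimension `k` has an orthonormal basis with `k` elements. -/
theorem exists_orthonormal_colSpan {W : Submodule ℝ (EuclideanSpace ℝ (Fin n))} (hW : W ∈ Gr k n) :
    ∃ Y : Matrix (Fin n) (Fin k) ℝ, Yᵀ * Y = 1 ∧ colSpan Y = W := by
  have hk : Module.finrank ℝ W = k := hW
  let b := (stdOrthonormalBasis ℝ W).reindex (finCongr hk)
  let Y : Matrix (Fin n) (Fin k) ℝ := Matrix.of fun r i => (b i : EuclideanSpace ℝ (Fin n)) r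
  have hcol : ∀ i, colVec Y i = b i := fun i => rfl
  have hY : Yᵀ * Y = 1 := by
    ext i j
    rw [← inner_colVec, hcol, hcol, ← Submodule.coe_inner, b.inner_eq_ite, Matrix.one_apply]
  refine ⟨Y, hY, Submodule.eq_of_le_of_finrank_eq ?_ (by rw [finrank_colSpan hY, hk])⟩
  exact Submodule.span_le.2 (by rintro _ ⟨i, rfl⟩; exact (b i).2)

theorem projMatrix_transpose {W : Submodule ℝ (EuclideanSpace ℝ (Fin n))} (hW : W ∈ Gr k n) :
    (projMatrix W)ᵀ = projMatrix W := by
  obtain ⟨Y, hY, rfl⟩ := exists_orthonormal_colSpan hW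
  rw [projMatrix_colSpan hY, Matrix.transpose_mul, Matrix.transpose_transpose]

theorem projMatrix_mul_self {W : Submodule ℝ (EuclideanSpace ℝ (Fin n))} (hW : W ∈ Gr k n) :
    projMatrix W * projMatrix W = projMatrix W := by
  obtain ⟨Y, hY, rfl⟩ := exists_orthonormal_colSpan hW
  rw [projMatrix_colSpan hY, Matrix.mul_assoc, ← Matrix.mul_assoc Yᵀ, hY, Matrix.one_mul]

/-- If the columns of `Y` are orthonormal and fixed by the projection onto `W`, then they form a
basis of `W`. -/
theorem colSpan_eq_of_projMatrix_mul {W : Submodule ℝ (EuclideanSpace ℝ (Fin n))} (hW : W ∈ Gr k n)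
    {Y : Matrix (Fin n) (Fin k) ℝ} (hY : Yᵀ * Y = 1) (h : projMatrix W * Y = Y) :
    colSpan Y = W := by
  have hk : Module.finrank ℝ W = k := hW
  obtain ⟨Z, hZ, rfl⟩ := exists_orthonormal_colSpan hW
  refine Submodule.eq_of_le_of_finrank_eq ?_ (by rw [finrank_colSpan hY, hk])
  rw [projMatrix_colSpan hZ, Matrix.mul_assoc] at h
  rw [← h]
  exact colSpan_mul_le _ _

theorem projMatrix_mul_of_colVec_mem {W : Submodule ℝ (EuclideanSpace ℝ (Fin n))}
    {m : ℕ} {Y : Matrix (Fin n) (Fin m) ℝ} (h : ∀ i, colVec Y i ∈ W) :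
    projMatrix W * Y = Y := by
  refine eq_of_colVec_eq fun i => ?_
  have h1 : Matrix.toEuclideanLin (projMatrix W) (colVec Y i) = colVec Y i := by
    unfold projMatrix
    rw [LinearEquiv.apply_symm_apply]
    exact Submodule.starProjection_eq_self_iff.2 (h i)
  rw [Matrix.toLpLin_apply] at h1
  exact h1

end Columns

/-! ### Horizontal lifts of curves in the Grassmannian -/

section Lift

variable {n k : ℕ} {c : ℝ → Submodule ℝ (EuclideanSpace ℝ (Fin n))}

theorem IsGrCurve.hasDerivWithinAt (hc : IsGrCurve k 1 c) {t : ℝ} (ht : t ∈ Icc (0 : ℝ) 1) :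
    HasDerivWithinAt (fun s => projMatrix (c s)) (grVelocity c t) (Icc 0 1) t :=
  (hc.2.differentiableOn (by norm_num) t ht).hasDerivWithinAt

theorem IsGrCurve.continuousOn_grVelocity (hc : IsGrCurve k 1 c) :
    ContinuousOn (grVelocity c) (Icc 0 1) :=
  hc.2.continuousOn_derivWithin uniqueDiffOn_Icc_zero_one (by norm_num)

/-- The velocity of a curve in the Grassmannian is tangent to it. -/
theorem IsGrCurve.grVelocity_mem_grTangent (hc : IsGrCurve k 1 c) {t : ℝ}
    (ht : t ∈ Icc (0 : ℝ) 1) : grVelocity c t ∈ grTangent (c t) := by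
  have hu := uniqueDiffOn_Icc_zero_one t ht
  have hd := hc.hasDerivWithinAt ht
  refine ⟨hu.eq_deriv _ (hd.matrixTranspose.congr_of_mem (fun s hs => ?_) ht) hd,
    hu.eq_deriv _ ((hd.matrixMul hd).congr_of_mem (fun s hs => ?_) ht) hd⟩
  · exact (projMatrix_transpose (hc.1 s hs)).symm
  · exact (projMatrix_mul_self (hc.1 s hs)).symm

/-- A `C¹` curve in the Grassmannian lifts to a horizontal curve `Y` of orthonormal bases, the
solution of `Y' = P' Y` where `P` is the curve of projections. The Frobenius speed of `Y` is the
Riemannian speed of the curve. -/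
theorem IsGrCurve.exists_horizontal_lift (hc : IsGrCurve k 1 c) {M : Matrix (Fin n) (Fin k) ℝ}
    (hM : Mᵀ * M = 1) (h0 : c 0 = colSpan M) :
    ∃ Y : ℝ → Matrix (Fin n) (Fin k) ℝ, Y 0 = M ∧
      (∀ t ∈ Icc (0 : ℝ) 1, HasDerivWithinAt Y (grVelocity c t * Y t) (Icc 0 1) t) ∧
      (∀ t ∈ Icc (0 : ℝ) 1, (Y t)ᵀ * Y t = 1) ∧ (∀ t ∈ Icc (0 : ℝ) 1, colSpan (Y t) = c t) ∧
      ∀ t ∈ Icc (0 : ℝ) 1,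
        ‖grVelocity c t * Y t‖ ^ 2 = grMetric (grVelocity c t) (grVelocity c t) := by
  have hV := hc.continuousOn_grVelocity
  have hAc : ContinuousOn (fun t => matrixMulCLM (Fin n) (Fin n) (Fin k) (grVelocity c t))
      (Icc 0 1) := (matrixMulCLM _ _ _).continuous.comp_continuousOn hV
  obtain ⟨Y, hY0, hY⟩ := exists_hasDerivWithinAt_linear hAc M
  replace hY : ∀ t ∈ Icc (0 : ℝ) 1, HasDerivWithinAt Y (grVelocity c t * Y t) (Icc 0 1) t := hY
  -- `P P' P = 0`, since `P' = P P' + P' P` and `P² = P`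
  have hPVP : ∀ t ∈ Icc (0 : ℝ) 1, projMatrix (c t) * grVelocity c t * projMatrix (c t) = 0 := by
    intro t ht
    have h1 := congrArg (fun X => projMatrix (c t) * X) (hc.grVelocity_mem_grTangent ht).2
    simp only [Matrix.mul_add, ← Matrix.mul_assoc, projMatrix_mul_self (hc.1 t ht)] at h1
    simpa using h1
  have hPY : ∀ t ∈ Icc (0 : ℝ) 1, projMatrix (c t) * Y t = Y t := by
    -- `Z = Y - P Y` satisfies the linear equation `Z' = - P' Z`
    have hZ := eq_zero_of_hasDerivWithinAt_linear (Z := fun t => Y t - projMatrix (c t) * Y t)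
      (A := fun t => matrixMulCLM (Fin n) (Fin n) (Fin k) (-grVelocity c t))
      ((matrixMulCLM _ _ _).continuous.comp_continuousOn hV.neg) ?_ fun t ht => ?_
    · intro t ht
      exact (sub_eq_zero.1 (hZ t ht)).symm
    · rw [hY0, h0, projMatrix_colSpan hM, Matrix.mul_assoc, hM, Matrix.mul_one, sub_self]
    · refine ((hY t ht).sub ((hc.hasDerivWithinAt ht).matrixMul (hY t ht))).congr_deriv ?_
      have h2 := (hc.grVelocity_mem_grTangent ht).2
      have h3 : projMatrix (c t) * (grVelocity c t * Y t) =
          grVelocity c t * Y t - grVelocity c t * (projMatrix (c t) * Y t) := by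
        rw [← Matrix.mul_assoc, ← Matrix.mul_assoc, ← Matrix.sub_mul]
        congr 1
        exact eq_sub_of_add_eq h2
      change _ = -grVelocity c t * (Y t - projMatrix (c t) * Y t)
      rw [h3, Matrix.neg_mul, Matrix.mul_sub]
      abel
  have hPT : ∀ t ∈ Icc (0 : ℝ) 1, (Y t)ᵀ * projMatrix (c t) = (Y t)ᵀ := fun t ht => by
    conv_rhs => rw [← hPY t ht, Matrix.transpose_mul, projMatrix_transpose (hc.1 t ht)]
  have hYVY : ∀ t ∈ Icc (0 : ℝ) 1, (Y t)ᵀ * (grVelocity c t * Y t) = 0 := fun t ht => by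
    rw [← hPT t ht]
    conv_lhs => rw [← hPY t ht]
    have := hPVP t ht
    simp only [Matrix.mul_assoc] at this ⊢
    rw [← Matrix.mul_assoc (grVelocity c t), ← Matrix.mul_assoc (projMatrix (c t)),
      this, Matrix.zero_mul, Matrix.mul_zero]
  have hYY : ∀ t ∈ Icc (0 : ℝ) 1, (Y t)ᵀ * Y t = 1 := by
    have hder : ∀ t ∈ Icc (0 : ℝ) 1,
        HasDerivWithinAt (fun t => (Y t)ᵀ * Y t) 0 (Icc 0 1) t := fun t ht => by
      refine ((hY t ht).matrixTranspose.matrixMul (hY t ht)).congr_deriv ?_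
      have h1 := congrArg Matrix.transpose (hYVY t ht)
      rw [Matrix.transpose_mul, Matrix.transpose_transpose, Matrix.transpose_zero] at h1
      rw [hYVY t ht, h1, add_zero]
    intro t ht
    have := constant_of_has_deriv_right_zero
      (fun t ht => (hder t ht).continuousWithinAt) (fun t ht =>
        (hder t (Ico_subset_Icc_self ht)).mono_of_mem_nhdsWithin (Icc_mem_nhdsGE_of_mem ht)) t ht
    rw [this, hY0, hM]
  have hspan : ∀ t ∈ Icc (0 : ℝ) 1, colSpan (Y t) = c t := fun t ht =>
    colSpan_eq_of_projMatrix_mul (hc.1 t ht) (hYY t ht) (hPY t ht)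
  refine ⟨Y, hY0, hY, hYY, hspan, fun t ht => ?_⟩
  obtain ⟨hsym, htan⟩ := hc.grVelocity_mem_grTangent ht
  have hP : projMatrix (c t) = Y t * (Y t)ᵀ := by rw [← hspan t ht, projMatrix_colSpan (hYY t ht)]
  unfold grMetric
  rw [norm_sq_eq_trace]
  set V := grVelocity c t
  set P := projMatrix (c t)
  have h1 : ((V * Y t)ᵀ * (V * Y t)).trace = (V * V * P).trace := by
    rw [hP, Matrix.transpose_mul, hsym, Matrix.trace_mul_comm, ← Matrix.mul_assoc,
      Matrix.trace_mul_comm]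
    simp only [Matrix.mul_assoc]
  have h2 : (V * V).trace = (V * P * V).trace + (V * V * P).trace := by
    have h : (V * V).trace = (V * (P * V + V * P)).trace := by rw [htan]
    rwa [Matrix.mul_add, Matrix.trace_add, ← Matrix.mul_assoc, ← Matrix.mul_assoc] at h
  have h3 : (V * P * V).trace = (V * V * P).trace := by
    rw [Matrix.trace_mul_comm, ← Matrix.mul_assoc]
  rw [h1, hsym]
  linarith

end Lift

/-! ### The lower bound for the length -/

section Bound

variable {n k : ℕ} {c : ℝ → Submodule ℝ (EuclideanSpace ℝ (Fin n))}
  {M M' : Matrix (Fin n) (Fin k) ℝ} {θ : Fin k → ℝ}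

/-- If `M` and `M'` are bases adapted to the principal angles, then in any other orthonormal basis
`Z` of the column space of `M'` the `i`-th vector makes an angle of at least `θ i` with the `i`-th
vector of `M`, because the factor `⟪M'ᵢ, Zᵢ⟫` is at most `1`. -/
theorem inner_colVec_eq_cos_mul (hM' : M'ᵀ * M' = 1)
    (hC : Mᵀ * M' = Matrix.diagonal fun i => Real.cos (θ i)) {Z : Matrix (Fin n) (Fin k) ℝ}
    (hZM : colSpan Z = colSpan M') (i : Fin k) :
    ⟪colVec M i, colVec Z i⟫ = Real.cos (θ i) * ⟪colVec M' i, colVec Z i⟫ := by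
  have h1 : projMatrix (colSpan M') * Z = Z :=
    projMatrix_mul_of_colVec_mem fun i => hZM ▸ colVec_mem_colSpan Z i
  rw [inner_colVec, inner_colVec]
  conv_lhs => rw [← h1, projMatrix_colSpan hM', ← Matrix.mul_assoc, ← Matrix.mul_assoc, hC,
    Matrix.mul_assoc, Matrix.diagonal_mul]

theorem inner_colVec_le_one (hM' : M'ᵀ * M' = 1) {Z : Matrix (Fin n) (Fin k) ℝ} (hZ : Zᵀ * Z = 1)
    (i : Fin k) : ⟪colVec M' i, colVec Z i⟫ ≤ 1 := by
  have := real_inner_le_norm (colVec M' i) (colVec Z i)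
  rwa [norm_colVec_eq_one hM', norm_colVec_eq_one hZ, one_mul] at this

/-- The energy of a curve of orthonormal bases, the sum of the energies of its columns, which are
curves on the unit sphere. -/
theorem energy_identity (hθ : ∀ i, θ i ∈ Icc 0 (Real.pi / 2)) (hM' : M'ᵀ * M' = 1)
    (hC : Mᵀ * M' = Matrix.diagonal fun i => Real.cos (θ i))
    {Y Y' : ℝ → Matrix (Fin n) (Fin k) ℝ} (hY0 : Y 0 = M) (hY1 : colSpan (Y 1) = colSpan M')
    (hY : ∀ t ∈ Icc (0 : ℝ) 1, HasDerivWithinAt Y (Y' t) (Icc 0 1) t)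
    (hY' : ContinuousOn Y' (Icc 0 1)) (hYY : ∀ t ∈ Icc (0 : ℝ) 1, (Y t)ᵀ * Y t = 1)
    {σ w : ℝ → ℝ} (hσ : ∀ t ∈ Icc (0 : ℝ) 1, HasDerivWithinAt σ (w t) (Icc 0 1) t)
    (hσI : ∀ t ∈ Icc (0 : ℝ) 1, σ t ∈ Icc (0 : ℝ) 1)
    (hw : ContinuousOn w (Icc 0 1)) (hw0 : ∀ t ∈ Icc (0 : ℝ) 1, 0 < w t)
    (hσ0 : σ 0 = 0) (hσ1 : σ 1 = 1) :
    ∫ t in (0 : ℝ)..1, ‖Y' t‖ ^ 2 / w t = ∑ i, θ i ^ 2 +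
      ∑ i, (2 * θ i / Real.sin (θ i) * (Real.cos (θ i) * (1 - ⟪colVec M' i, colVec (Y 1) i⟫)) +
        ∫ t in (0 : ℝ)..1, ‖colVec (Y' t) i -
          w t • arcField (θ i) (colVec M i) (colVec (Y 1) i) (σ t) (colVec (Y t) i)‖ ^ 2 / w t) := by
  have hcont : ∀ i, ContinuousOn (fun t => colVec (Y' t) i) (Icc 0 1) := fun i =>
    (colVecCLM i).continuous.comp_continuousOn hY'
  have hsum : ∀ t, ‖Y' t‖ ^ 2 / w t = ∑ i, ‖colVec (Y' t) i‖ ^ 2 / w t := fun t => by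
    rw [norm_sq_eq_trace, ← sum_norm_colVec_sq, Finset.sum_div]
  simp only [hsum]
  rw [intervalIntegral.integral_finsetSum, ← Finset.sum_add_distrib]
  · refine Finset.sum_congr rfl fun i _ => ?_
    rw [sphere_energy_identity (hθ i) (fun t ht => (hY t ht).colVec i) (hcont i)
      (fun t ht => norm_colVec_eq_one (hYY t ht) i) hσ hσI hw hw0 hσ0 hσ1, hY0,
      inner_colVec_eq_cos_mul hM' hC hY1 i]
    ring
  · intro i _
    exact (((hcont i).norm.pow 2).div hw fun t ht => (hw0 t ht).ne').intervalIntegrable_of_Icc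
      zero_le_one

theorem two_mul_div_sin_mul_nonneg (hθ : ∀ i, θ i ∈ Icc 0 (Real.pi / 2)) (hM' : M'ᵀ * M' = 1)
    {Z : Matrix (Fin n) (Fin k) ℝ} (hZ : Zᵀ * Z = 1) (i : Fin k) :
    0 ≤ 2 * θ i / Real.sin (θ i) *
      (Real.cos (θ i) * (1 - ⟪colVec M' i, colVec Z i⟫)) := by
  have hpi := Real.pi_pos
  have h := hθ i
  exact mul_nonneg (div_nonneg (by linarith [h.1])
      (Real.sin_nonneg_of_nonneg_of_le_pi h.1 (by linarith [h.2])))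
    (mul_nonneg (Real.cos_nonneg_of_mem_Icc ⟨by linarith [h.1], h.2⟩)
      (sub_nonneg.2 (inner_colVec_le_one hM' hZ i)))

theorem integral_div_nonneg {f w : ℝ → ℝ} (hw0 : ∀ t ∈ Icc (0 : ℝ) 1, 0 < w t)
    (hf : ∀ t, 0 ≤ f t) : 0 ≤ ∫ t in (0 : ℝ)..1, f t / w t :=
  intervalIntegral.integral_nonneg zero_le_one fun t ht => div_nonneg (hf t) (hw0 t ht).le

theorem grMetric_self_nonneg (X : Matrix (Fin n) (Fin n) ℝ) : 0 ≤ grMetric X X := by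
  unfold grMetric
  rw [← norm_sq_eq_trace]
  positivity

theorem IsGrCurve.continuousOn_speed (hc : IsGrCurve k 1 c) :
    ContinuousOn (fun t => Real.sqrt (grMetric (grVelocity c t) (grVelocity c t))) (Icc 0 1) := by
  refine Real.continuous_sqrt.comp_continuousOn ?_
  unfold grMetric
  simp only [← norm_sq_eq_trace]
  exact (hc.continuousOn_grVelocity.norm.pow 2).div_const 2

/-- No curve is shorter than `(∑ θᵢ²)^(1/2)`. The energy identity is applied with the parameter
speed `w = (v + ε) / (L + ε)`, where `v` is the speed and `L` the length of the curve; for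
`ε = 0` this would be the parametrization by arc length, and `ε > 0` keeps `w` positive. -/
theorem IsGrCurve.sqrt_sum_sq_le_grLength (hc : IsGrCurve k 1 c)
    (hθ : ∀ i, θ i ∈ Icc 0 (Real.pi / 2)) (hM : Mᵀ * M = 1) (hM' : M'ᵀ * M' = 1)
    (hC : Mᵀ * M' = Matrix.diagonal fun i => Real.cos (θ i))
    (h0 : c 0 = colSpan M) (h1 : c 1 = colSpan M') :
    Real.sqrt (∑ i, θ i ^ 2) ≤ grLength c := by
  obtain ⟨Y, hY0, hY, hYY, hspan, hnorm⟩ := hc.exists_horizontal_lift hM h0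
  set v : ℝ → ℝ := fun t => Real.sqrt (grMetric (grVelocity c t) (grVelocity c t))
  have hvc : ContinuousOn v (Icc 0 1) := hc.continuousOn_speed
  have hv0 : ∀ t, 0 ≤ v t := fun t => Real.sqrt_nonneg _
  have hL : grLength c = ∫ t in (0 : ℝ)..1, v t := rfl
  set L := grLength c
  have hL0 : 0 ≤ L := hL ▸ intervalIntegral.integral_nonneg zero_le_one fun t _ => hv0 t
  have hY'c : ContinuousOn (fun t => grVelocity c t * Y t) (Icc 0 1) := fun t ht =>
    ((matrixMulCLM (Fin n) (Fin n) (Fin k)).continuous.continuousAt.comp_continuousWithinAt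
      (hc.continuousOn_grVelocity t ht)).clm_apply (hY t ht).continuousWithinAt
  -- a continuous extension of the speed to the real line
  set u : ℝ → ℝ := fun t => v (projIcc (0 : ℝ) 1 zero_le_one t) with hu
  have huc : Continuous u :=
    hvc.comp_continuous (continuous_subtype_val.comp continuous_projIcc) fun t => Subtype.coe_prop _
  have huv : ∀ t ∈ Icc (0 : ℝ) 1, u t = v t := fun t ht => by
    simp only [hu, projIcc_of_mem zero_le_one ht]
  have hLu : ∫ t in (0 : ℝ)..1, u t = L := by
    rw [hL]
    refine intervalIntegral.integral_congr fun t ht => huv t ?_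
    rwa [uIcc_of_le zero_le_one] at ht
  suffices h : ∀ ε > 0, ∑ i, θ i ^ 2 ≤ (L + ε) * L by
    refine Real.sqrt_le_iff.2 ⟨hL0, le_of_forall_pos_le_add fun δ hδ => ?_⟩
    have h2 := h (δ / (L + 1)) (by positivity)
    have h3 : δ / (L + 1) * L ≤ δ := by
      rw [div_mul_eq_mul_div, div_le_iff₀ (by linarith)]
      nlinarith
    linarith
  intro ε hε
  have hLε : 0 < L + ε := by linarith
  set w : ℝ → ℝ := fun t => (u t + ε) / (L + ε) with hw
  have hwc : Continuous w := (huc.add continuous_const).div_const _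
  have hw0 : ∀ t, 0 < w t := fun t => div_pos (add_pos_of_nonneg_of_pos (hv0 _) hε) hLε
  have hw1 : ∫ t in (0 : ℝ)..1, w t = 1 := by
    simp only [hw]
    rw [intervalIntegral.integral_div, intervalIntegral.integral_add
      (huc.intervalIntegrable _ _) (by simp), hLu]
    simp [hLε.ne']
  have hwi : ∀ a b, IntervalIntegrable w MeasureTheory.volume a b := fun a b =>
    hwc.intervalIntegrable a b
  have hE := energy_identity hθ hM' hC hY0 ((hspan 1 (by simp)).trans h1) hY hY'c hYY
    (σ := fun t => ∫ s in (0 : ℝ)..t, w s) (w := w)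
    (fun t _ => (hwc.integral_hasStrictDerivAt 0 t).hasDerivAt.hasDerivWithinAt)
    (fun t ht => ⟨intervalIntegral.integral_nonneg ht.1 fun s _ => (hw0 s).le, by
      rw [← hw1, ← intervalIntegral.integral_add_adjacent_intervals (hwi 0 t) (hwi t 1)]
      linarith [intervalIntegral.integral_nonneg (μ := MeasureTheory.volume) ht.2
        fun s _ => (hw0 s).le]⟩)
    hwc.continuousOn (fun t _ => hw0 t) (by simp) hw1
  have hle : ∫ t in (0 : ℝ)..1, ‖grVelocity c t * Y t‖ ^ 2 / w t ≤ (L + ε) * L := by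
    have hR : (L + ε) * L = ∫ t in (0 : ℝ)..1, (L + ε) * u t := by
      rw [intervalIntegral.integral_const_mul, hLu]
    rw [hR]
    refine intervalIntegral.integral_mono_on zero_le_one
      (ContinuousOn.intervalIntegrable_of_Icc zero_le_one
        ((hY'c.norm.pow 2).div hwc.continuousOn fun t _ => (hw0 t).ne'))
      ((huc.const_mul _).intervalIntegrable _ _) fun t ht => ?_
    have hut : 0 ≤ u t := hv0 _
    rw [hnorm t ht, ← Real.sq_sqrt (grMetric_self_nonneg _)]
    change v t ^ 2 / _ ≤ _
    rw [← huv t ht]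
    simp only [hw]
    rw [div_div_eq_mul_div, div_le_iff₀ (by linarith)]
    nlinarith [mul_nonneg hLε.le (mul_nonneg hut hε.le)]
  have hpos : 0 ≤ ∑ i, (2 * θ i / Real.sin (θ i) *
      (Real.cos (θ i) * (1 - ⟪colVec M' i, colVec (Y 1) i⟫)) +
        ∫ t in (0 : ℝ)..1, ‖colVec (grVelocity c t * Y t) i -
          w t • arcField (θ i) (colVec M i) (colVec (Y 1) i) (∫ s in (0 : ℝ)..t, w s)
            (colVec (Y t) i)‖ ^ 2 / w t) :=
    Finset.sum_nonneg fun i _ => add_nonneg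
      (two_mul_div_sin_mul_nonneg hθ hM' (hYY 1 (by simp)) i)
      (integral_div_nonneg (fun t _ => hw0 t) fun t => by positivity)
  linarith

end Bound

/-! ### Uniqueness of the shortest geodesic -/

section Unique

theorem eq_zero_of_integral_le_zero {f : ℝ → ℝ} (hf : ContinuousOn f (Icc 0 1))
    (h0 : ∀ t, 0 ≤ f t) (h : ∫ t in (0 : ℝ)..1, f t ≤ 0) : ∀ t ∈ Icc (0 : ℝ) 1, f t = 0 := by
  intro t ht
  by_contra hne
  have := intervalIntegral.integral_pos zero_lt_one hf (fun s _ => h0 s)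
    ⟨t, ht, (h0 t).lt_of_ne' hne⟩
  linarith

theorem eq_of_hasDerivWithinAt_arcField {E : Type*} [NormedAddCommGroup E] [InnerProductSpace ℝ E]
    {θ : ℝ} (hθ : θ ∈ Icc 0 (Real.pi / 2)) {a b : E} {y z : ℝ → E} (h0 : y 0 = z 0)
    (hy : ∀ t ∈ Icc (0 : ℝ) 1, HasDerivWithinAt y (arcField θ a b t (y t)) (Icc 0 1) t)
    (hz : ∀ t ∈ Icc (0 : ℝ) 1, HasDerivWithinAt z (arcField θ a b t (z t)) (Icc 0 1) t) :
    ∀ t ∈ Icc (0 : ℝ) 1, y t = z t := by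
  have hp : ContinuousOn (fun t : ℝ => -(θ * Real.tan (θ * (t - 1 / 2)))) (Icc 0 1) := by
    have hl : Continuous fun t : ℝ => θ * (t - 1 / 2) := by fun_prop
    simp only [Real.tan_eq_sin_div_cos]
    exact (continuousOn_const.mul ((Real.continuous_sin.comp hl).continuousOn.div
      (Real.continuous_cos.comp hl).continuousOn
      fun t ht => (cos_mul_sub_half_pos hθ ht).ne')).neg
  have hA : ContinuousOn (fun t : ℝ => (-(θ * Real.tan (θ * (t - 1 / 2)))) •
    ContinuousLinearMap.id ℝ E) (Icc 0 1) := hp.smul continuousOn_const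
  intro t ht
  refine sub_eq_zero.1 (eq_zero_of_hasDerivWithinAt_linear hA (Z := fun t => y t - z t)
    (sub_eq_zero.2 h0) (fun t ht => ((hy t ht).sub (hz t ht)).congr_deriv ?_) t ht)
  simp only [arcField, _root_.smul_apply, ContinuousLinearMap.id_apply]
  module

variable {n k : ℕ} {c : ℝ → Submodule ℝ (EuclideanSpace ℝ (Fin n))}
  {M M' : Matrix (Fin n) (Fin k) ℝ} {θ : Fin k → ℝ}

theorem IsGrGeodesic.isGrCurve_one (hc : IsGrGeodesic k c) : IsGrCurve k 1 c :=
  ⟨hc.1.1, hc.1.2.of_le (by norm_num)⟩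

/-- A geodesic is parametrized proportionally to arc length. -/
theorem IsGrGeodesic.grMetric_grVelocity (hc : IsGrGeodesic k c) :
    ∀ t ∈ Icc (0 : ℝ) 1, grMetric (grVelocity c t) (grVelocity c t) = grLength c ^ 2 := by
  have hd : ∀ t ∈ Icc (0 : ℝ) 1, HasDerivWithinAt (grVelocity c)
      (derivWithin (grVelocity c) (Icc 0 1) t) (Icc 0 1) t := fun t ht => by
    have h2 : ContDiffOn ℝ 1 (grVelocity c) (Icc 0 1) :=
      hc.1.2.derivWithin uniqueDiffOn_Icc_zero_one (by norm_num)
    exact (h2.differentiableOn (by norm_num) t ht).hasDerivWithinAt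
  let T : Matrix (Fin n) (Fin n) ℝ →L[ℝ] ℝ :=
    LinearMap.toContinuousLinearMap (Matrix.traceLinearMap (Fin n) ℝ ℝ)
  have hg : ∀ t ∈ Icc (0 : ℝ) 1,
      HasDerivWithinAt (fun t => grMetric (grVelocity c t) (grVelocity c t)) 0 (Icc 0 1) t := by
    intro t ht
    have h1 := (T.hasFDerivAt.comp_hasDerivWithinAt t
      ((hd t ht).matrixTranspose.matrixMul (hd t ht))).div_const 2
    refine h1.congr_deriv ?_
    have h2 := hc.2 t ht _ (hc.isGrCurve_one.grVelocity_mem_grTangent ht)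
    set X := derivWithin (grVelocity c) (Icc 0 1) t
    set V := grVelocity c t
    have h3 : (Vᵀ * X).trace = (Xᵀ * V).trace := by
      rw [← Matrix.trace_transpose, Matrix.transpose_mul, Matrix.transpose_transpose]
    change (Vᵀ * X + Xᵀ * V).trace / 2 = 0
    rw [Matrix.trace_add, h3]
    unfold grMetric at h2
    linarith
  have hconst : ∀ t ∈ Icc (0 : ℝ) 1, grMetric (grVelocity c t) (grVelocity c t) =
      grMetric (grVelocity c 0) (grVelocity c 0) :=
    constant_of_has_deriv_right_zero (fun t ht => (hg t ht).continuousWithinAt) fun t ht =>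
      (hg t (Ico_subset_Icc_self ht)).mono_of_mem_nhdsWithin (Icc_mem_nhdsGE_of_mem ht)
  have hL : grLength c = Real.sqrt (grMetric (grVelocity c 0) (grVelocity c 0)) := by
    unfold grLength
    rw [intervalIntegral.integral_congr (g := fun _ =>
      Real.sqrt (grMetric (grVelocity c 0) (grVelocity c 0)))]
    · simp
    · intro t ht
      rw [uIcc_of_le zero_le_one] at ht
      simp only [hconst t ht]
  intro t ht
  rw [hL, Real.sq_sqrt (grMetric_self_nonneg _), hconst t ht]

/-- If all principal angles are less than `π / 2`, a geodesic of length at most `(∑ θᵢ²)^(1/2)` has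
a lift that ends at `M'`, and the columns of that lift are the great circle arcs: all
nonnegative terms in the energy identity vanish. -/
theorem IsGrGeodesic.exists_lift_arcField (hc : IsGrGeodesic k c)
    (hθ : ∀ i, θ i ∈ Icc 0 (Real.pi / 2)) (hθ' : ∀ i, θ i < Real.pi / 2)
    (hM : Mᵀ * M = 1) (hM' : M'ᵀ * M' = 1)
    (hC : Mᵀ * M' = Matrix.diagonal fun i => Real.cos (θ i))
    (h0 : c 0 = colSpan M) (h1 : c 1 = colSpan M')
    (hlen : grLength c ≤ Real.sqrt (∑ i, θ i ^ 2)) :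
    ∃ Y : ℝ → Matrix (Fin n) (Fin k) ℝ, Y 0 = M ∧
      (∀ t ∈ Icc (0 : ℝ) 1, colSpan (Y t) = c t) ∧
      ∀ i, ∀ t ∈ Icc (0 : ℝ) 1, HasDerivWithinAt (fun t => colVec (Y t) i)
        (arcField (θ i) (colVec M i) (colVec M' i) t (colVec (Y t) i)) (Icc 0 1) t := by
  have hc1 := hc.isGrCurve_one
  obtain ⟨Y, hY0, hY, hYY, hspan, hnorm⟩ := hc1.exists_horizontal_lift hM h0
  have hY'c : ContinuousOn (fun t => grVelocity c t * Y t) (Icc 0 1) := fun t ht =>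
    ((matrixMulCLM (Fin n) (Fin n) (Fin k)).continuous.continuousAt.comp_continuousWithinAt
      (hc1.continuousOn_grVelocity t ht)).clm_apply (hY t ht).continuousWithinAt
  have hE := energy_identity hθ hM' hC hY0 ((hspan 1 (by simp)).trans h1) hY hY'c hYY
    (σ := fun t => t) (w := fun _ => 1) (fun t _ => hasDerivWithinAt_id t _) (fun t ht => ht)
    continuousOn_const (fun t _ => one_pos) rfl rfl
  have hnn : 0 ≤ ∑ i, θ i ^ 2 := Finset.sum_nonneg fun i _ => sq_nonneg _
  have hL0 : 0 ≤ grLength c :=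
    intervalIntegral.integral_nonneg zero_le_one fun t _ => Real.sqrt_nonneg _
  have hle : ∫ t in (0 : ℝ)..1, ‖grVelocity c t * Y t‖ ^ 2 / 1 ≤ ∑ i, θ i ^ 2 := by
    rw [intervalIntegral.integral_congr (g := fun _ => grLength c ^ 2)]
    · rw [Real.le_sqrt hL0 hnn] at hlen
      simpa using hlen
    · intro t ht
      rw [uIcc_of_le zero_le_one] at ht
      simp only [hnorm t ht, hc.grMetric_grVelocity t ht, div_one]
  set D : Fin k → ℝ → ℝ := fun i t => ‖colVec (grVelocity c t * Y t) i -
    (1 : ℝ) • arcField (θ i) (colVec M i) (colVec (Y 1) i) t (colVec (Y t) i)‖ ^ 2 / 1 with hD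
  have hD0 : ∀ i t, 0 ≤ D i t := fun i t => by simp only [hD]; positivity
  have hI0 : ∀ i, 0 ≤ ∫ t in (0 : ℝ)..1, D i t := fun i =>
    intervalIntegral.integral_nonneg zero_le_one fun t _ => hD0 i t
  have hB0 := two_mul_div_sin_mul_nonneg hθ hM' (hYY 1 (by simp))
  have hzero := (Finset.sum_eq_zero_iff_of_nonneg
    (fun i _ => add_nonneg (hB0 i) (hI0 i))).1 (le_antisymm
      ((add_le_iff_nonpos_right _).1 (hE.symm.trans_le hle))
      (Finset.sum_nonneg fun i _ => add_nonneg (hB0 i) (hI0 i)))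
  have hderiv : ∀ i, ∀ t ∈ Icc (0 : ℝ) 1, colVec (grVelocity c t * Y t) i =
      arcField (θ i) (colVec M i) (colVec (Y 1) i) t (colVec (Y t) i) := by
    intro i t ht
    have h2 := hzero i (Finset.mem_univ i)
    have hcont : ContinuousOn (D i) (Icc 0 1) := by
      have hY1 : ContinuousOn (fun t => colVec (grVelocity c t * Y t) i) (Icc 0 1) :=
        (colVecCLM i).continuous.comp_continuousOn hY'c
      have hY2 := continuousOn_arcField (hθ i) (colVec M i) (colVec (Y 1) i) continuousOn_id
        (fun t ht => ht) (fun t ht => ((hY t ht).colVec i).continuousWithinAt)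
      exact (((hY1.sub (hY2.const_smul (1 : ℝ))).norm.pow 2).div_const 1)
    have h3 := eq_zero_of_integral_le_zero hcont (hD0 i)
      ((add_eq_zero_iff_of_nonneg (hB0 i) (hI0 i)).1 h2).2.le t ht
    simp only [hD, div_one, one_smul, sq_eq_zero_iff, norm_eq_zero] at h3
    exact sub_eq_zero.1 h3
  have hend : ∀ i, colVec (Y 1) i = colVec M' i := by
    intro i
    have hn1 := norm_colVec_eq_one hM' i
    have hn2 := norm_colVec_eq_one (hYY 1 (by simp)) i
    have hcos : 0 < Real.cos (θ i) :=
      Real.cos_pos_of_mem_Ioo ⟨by linarith [(hθ i).1, Real.pi_pos], hθ' i⟩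
    suffices h : ⟪colVec M' i, colVec (Y 1) i⟫ = 1 from
      ((inner_eq_one_iff_of_norm_eq_one hn1 hn2).1 h).symm
    rcases (hθ i).1.eq_or_lt with h | hpos
    · -- for the angle `0` the field vanishes, so the column is constant
      have hconst := constant_of_has_deriv_right_zero
        (fun t ht => ((hY t ht).colVec i).continuousWithinAt) (fun t ht => by
          have h4 := ((hY t (Ico_subset_Icc_self ht)).colVec i).mono_of_mem_nhdsWithin
            (Icc_mem_nhdsGE_of_mem ht)
          rw [hderiv i t (Ico_subset_Icc_self ht)] at h4
          simpa [arcField, ← h] using h4) 1 (by simp)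
      have h5 := inner_colVec_eq_cos_mul hM' hC ((hspan 1 (by simp)).trans h1) i
      rw [hconst, hY0, real_inner_self_eq_norm_sq, norm_colVec_eq_one hM, ← h,
        Real.cos_zero] at h5
      rw [hconst, hY0]
      linarith
    · have hsin : 0 < Real.sin (θ i) :=
        Real.sin_pos_of_pos_of_lt_pi hpos (by linarith [hθ' i, Real.pi_pos])
      have h2 := hzero i (Finset.mem_univ i)
      have h3 := ((add_eq_zero_iff_of_nonneg (hB0 i) (hI0 i)).1 h2).1
      have h4 : (1 - ⟪colVec M' i, colVec (Y 1) i⟫) = 0 := by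
        have : 2 * θ i / Real.sin (θ i) ≠ 0 := by positivity
        simpa [this, hcos.ne', hpos.ne', hsin.ne'] using h3
      linarith
  refine ⟨Y, hY0, hspan, fun i t ht => ?_⟩
  rw [← hend i, ← hderiv i t ht]
  exact (hY t ht).colVec i

theorem IsGrGeodesic.eq_of_grLength_le {d : ℝ → Submodule ℝ (EuclideanSpace ℝ (Fin n))}
    (hc : IsGrGeodesic k c) (hd : IsGrGeodesic k d)
    (hθ : ∀ i, θ i ∈ Icc 0 (Real.pi / 2)) (hθ' : ∀ i, θ i < Real.pi / 2)
    (hM : Mᵀ * M = 1) (hM' : M'ᵀ * M' = 1)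
    (hC : Mᵀ * M' = Matrix.diagonal fun i => Real.cos (θ i))
    (hc0 : c 0 = colSpan M) (hc1 : c 1 = colSpan M')
    (hd0 : d 0 = colSpan M) (hd1 : d 1 = colSpan M')
    (hcl : grLength c ≤ Real.sqrt (∑ i, θ i ^ 2)) (hdl : grLength d ≤ Real.sqrt (∑ i, θ i ^ 2)) :
    ∀ t ∈ Icc (0 : ℝ) 1, c t = d t := by
  obtain ⟨Y, hY0, hYs, hY⟩ := hc.exists_lift_arcField hθ hθ' hM hM' hC hc0 hc1 hcl
  obtain ⟨Z, hZ0, hZs, hZ⟩ := hd.exists_lift_arcField hθ hθ' hM hM' hC hd0 hd1 hdl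
  intro t ht
  rw [← hYs t ht, ← hZs t ht, eq_of_colVec_eq fun i =>
    eq_of_hasDerivWithinAt_arcField (hθ i) (by rw [hY0, hZ0]) (hY i) (hZ i) t ht]

end Unique

/-! ### Principal angles -/

section PrincipalAngles

variable {n k : ℕ} {M M' Δ : Matrix (Fin n) (Fin k) ℝ} {θ : Fin k → ℝ}

theorem eq_zero_of_forall_mul_add_mul_le {b c : ℝ}
    (h : ∀ p q : ℝ, p ^ 2 + q ^ 2 = 1 → p * c + q * b ≤ c) : b = 0 := by
  by_contra hb
  have hpos : 0 < c ^ 2 + b ^ 2 := by positivity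
  have hr := Real.sqrt_pos.2 hpos
  have hsq := Real.sq_sqrt hpos.le
  set r := Real.sqrt (c ^ 2 + b ^ 2)
  have h1 := h (c / r) (b / r) (by field_simp; linarith)
  have h2 : c / r * c + b / r * b = r := by field_simp; linarith
  rw [h2] at h1
  have hb2 : 0 < b ^ 2 := by positivity
  nlinarith

/-- The principal vectors form orthonormal bases `M * U` and `M' * V` of the two subspaces whose
matrix of inner products is `diag (cos θ)`. The off-diagonal entries vanish because turning one
vector of a maximizing pair towards a later vector does not increase the inner product. -/
theorem IsPrincipalAngles.exists_adapted (hM : Mᵀ * M = 1) (hM' : M'ᵀ * M' = 1)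
    (hθ : IsPrincipalAngles (colSpan M) (colSpan M') θ) :
    ∃ U V : Matrix (Fin k) (Fin k) ℝ, Uᵀ * U = 1 ∧ Vᵀ * V = 1 ∧
      (M * U)ᵀ * (M' * V) = Matrix.diagonal fun i => Real.cos (θ i) := by
  obtain ⟨-, -, u, v, h⟩ := hθ
  let W : Matrix (Fin n) (Fin k) ℝ := Matrix.of fun r i => u i r
  let W' : Matrix (Fin n) (Fin k) ℝ := Matrix.of fun r i => v i r
  have hW : ∀ i, colVec W i = u i := fun i => rfl
  have hW' : ∀ i, colVec W' i = v i := fun i => rfl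
  have hgram : ∀ x : Fin k → EuclideanSpace ℝ (Fin n), (∀ i, ‖x i‖ = 1) →
      (∀ i, ∀ j < i, ⟪x i, x j⟫ = 0) → ∀ i j, ⟪x i, x j⟫ = if i = j then 1 else 0 := by
    intro x h1 h2 i j
    rcases lt_trichotomy i j with hij | rfl | hij
    · rw [real_inner_comm, h2 j i hij, if_neg hij.ne]
    · rw [real_inner_self_eq_norm_sq, h1]; simp
    · rw [h2 i j hij, if_neg hij.ne']
  have hu := hgram u (fun i => (h i).2.2.1) fun i j hij => ((h i).2.2.2.2.1 j hij).1
  have hv := hgram v (fun i => (h i).2.2.2.1) fun i j hij => ((h i).2.2.2.2.1 j hij).2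
  have hnorm : ∀ x : Fin k → EuclideanSpace ℝ (Fin n),
      (∀ i j, ⟪x i, x j⟫ = if i = j then 1 else 0) → ∀ i j, i ≠ j → ∀ p q : ℝ,
      p ^ 2 + q ^ 2 = 1 → ‖p • x i + q • x j‖ = 1 := by
    intro x hx i j hij p q hpq
    have : ‖p • x i + q • x j‖ ^ 2 = 1 := by
      rw [← real_inner_self_eq_norm_sq]
      simp only [inner_add_left, inner_add_right, inner_smul_left, inner_smul_right, hx, hij,
        hij.symm, if_true, if_false, conj_trivial]
      linarith
    nlinarith [norm_nonneg (p • x i + q • x j)]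
  have horth : ∀ x : Fin k → EuclideanSpace ℝ (Fin n),
      (∀ i j, ⟪x i, x j⟫ = if i = j then 1 else 0) → ∀ i j, i < j → ∀ p q : ℝ,
      ∀ l < i, ⟪p • x i + q • x j, x l⟫ = 0 := by
    intro x hx i j hij p q l hl
    rw [inner_add_left, inner_smul_left, inner_smul_left, hx, hx, if_neg hl.ne',
      if_neg (hl.trans hij).ne']
    simp
  have huv : ∀ i j, ⟪u i, v j⟫ = if i = j then Real.cos (θ i) else 0 := by
    intro i j
    rcases lt_trichotomy i j with hij | rfl | hij
    · rw [if_neg hij.ne]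
      refine eq_zero_of_forall_mul_add_mul_le (c := Real.cos (θ i)) fun p q hpq => ?_
      have := (h i).2.2.2.2.2.2 (u i) (h i).1 (p • v i + q • v j)
        (Submodule.add_mem _ (Submodule.smul_mem _ _ (h i).2.1) (Submodule.smul_mem _ _ (h j).2.1))
        (h i).2.2.1 (hnorm v hv i j hij.ne p q hpq)
        fun l hl => ⟨((h i).2.2.2.2.1 l hl).1, horth v hv i j hij p q l hl⟩
      rwa [inner_add_right, inner_smul_right, inner_smul_right, (h i).2.2.2.2.2.1] at this
    · rw [if_pos rfl, (h i).2.2.2.2.2.1]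
    · rw [if_neg hij.ne']
      refine eq_zero_of_forall_mul_add_mul_le (c := Real.cos (θ j)) fun p q hpq => ?_
      have := (h j).2.2.2.2.2.2 (p • u j + q • u i)
        (Submodule.add_mem _ (Submodule.smul_mem _ _ (h j).1) (Submodule.smul_mem _ _ (h i).1))
        (v j) (h j).2.1 (hnorm u hu j i hij.ne p q hpq) (h j).2.2.2.1
        fun l hl => ⟨horth u hu j i hij p q l hl, ((h j).2.2.2.2.1 l hl).2⟩
      rwa [inner_add_left, inner_smul_left, inner_smul_left, (h j).2.2.2.2.2.1,
        conj_trivial, conj_trivial] at this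
  have hWW : Wᵀ * W = 1 := by
    ext i j
    rw [← inner_colVec, hW, hW, hu, Matrix.one_apply]
  have hWW' : W'ᵀ * W' = 1 := by
    ext i j
    rw [← inner_colVec, hW', hW', hv, Matrix.one_apply]
  have hMW : M * (Mᵀ * W) = W := by
    rw [← Matrix.mul_assoc, ← projMatrix_colSpan hM]
    exact projMatrix_mul_of_colVec_mem fun i => (h i).1
  have hMW' : M' * (M'ᵀ * W') = W' := by
    rw [← Matrix.mul_assoc, ← projMatrix_colSpan hM']
    exact projMatrix_mul_of_colVec_mem fun i => (h i).2.1
  refine ⟨Mᵀ * W, M'ᵀ * W', ?_, ?_, ?_⟩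
  · rw [Matrix.transpose_mul, Matrix.transpose_transpose, Matrix.mul_assoc, hMW, hWW]
  · rw [Matrix.transpose_mul, Matrix.transpose_transpose, Matrix.mul_assoc, hMW', hWW']
  · rw [hMW, hMW']
    ext i j
    rw [← inner_colVec, hW, hW', huv, Matrix.diagonal_apply]

/-- In `M' = M cos Θ + Δ sin Θ`, the columns of `Δ` that enter are orthogonal to those of `M`.
Orthonormality of `M'` gives `tr (cos Θ Mᵀ Δ sin Θ) = 0`, so that
`‖Mᵀ M'‖² = ‖cos Θ‖² + ‖Mᵀ Δ sin Θ‖²`; but the singular values of `Mᵀ M'` are the `cos θᵢ`. -/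
theorem transpose_mul_mul_diagonal_sin (hM : Mᵀ * M = 1) (hM' : M'ᵀ * M' = 1) (hΔ : Δᵀ * Δ = 1)
    (hθ : IsPrincipalAngles (colSpan M) (colSpan M') θ)
    (h : M' = M * Matrix.diagonal (fun i => Real.cos (θ i)) +
      Δ * Matrix.diagonal (fun i => Real.sin (θ i))) :
    Mᵀ * Δ * Matrix.diagonal (fun i => Real.sin (θ i)) = 0 := by
  obtain ⟨U, V, hU, hV, hUV⟩ := hθ.exists_adapted hM hM'
  set C : Matrix (Fin k) (Fin k) ℝ := Matrix.diagonal fun i => Real.cos (θ i) with hC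
  set S : Matrix (Fin k) (Fin k) ℝ := Matrix.diagonal fun i => Real.sin (θ i) with hS
  have hCt : Cᵀ = C := Matrix.diagonal_transpose _
  have hSt : Sᵀ = S := Matrix.diagonal_transpose _
  have hCS : C * C + S * S = 1 := by
    rw [hC, hS, Matrix.diagonal_mul_diagonal, Matrix.diagonal_mul_diagonal, Matrix.diagonal_add,
      ← Matrix.diagonal_one]
    congr 1
    ext i
    linarith [Real.sin_sq_add_cos_sq (θ i)]
  set N := Mᵀ * Δ * S with hN
  have hG : Mᵀ * M' = C + N := by
    rw [h, Matrix.mul_add, ← Matrix.mul_assoc, hM, Matrix.one_mul, hN, Matrix.mul_assoc]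
  have hUt := mul_eq_one_comm.1 hU
  have hVt := mul_eq_one_comm.1 hV
  have htr1 : ((Mᵀ * M')ᵀ * (Mᵀ * M')).trace = (C * C).trace := by
    have e : Uᵀ * (Mᵀ * M') * V = C := by
      rw [← hUV, Matrix.transpose_mul]
      simp only [Matrix.mul_assoc]
    have e2 : Mᵀ * M' = U * C * Vᵀ := by
      rw [← e]
      simp only [← Matrix.mul_assoc, hUt, Matrix.one_mul]
      rw [Matrix.mul_assoc _ V, hVt, Matrix.mul_one]
    rw [e2, Matrix.transpose_mul, Matrix.transpose_mul, Matrix.transpose_transpose, hCt,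
      Matrix.trace_mul_comm]
    have e3 : U * C * Vᵀ * (V * (C * Uᵀ)) = U * (C * C * Uᵀ) := by
      rw [Matrix.mul_assoc (U * C), ← Matrix.mul_assoc Vᵀ, hV, Matrix.one_mul]
      simp only [Matrix.mul_assoc]
    rw [e3, Matrix.trace_mul_comm, Matrix.mul_assoc, hU, Matrix.mul_one]
  have horth : C * N + Nᵀ * C = 0 := by
    have e : M'ᵀ * M' = C * C + S * S + (C * N + Nᵀ * C) := by
      rw [h, hN]
      simp only [Matrix.transpose_add, Matrix.transpose_mul, hCt, hSt, Matrix.transpose_transpose,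
        Matrix.add_mul, Matrix.mul_add, Matrix.mul_assoc]
      rw [← Matrix.mul_assoc Mᵀ M, hM, ← Matrix.mul_assoc Δᵀ Δ, hΔ, Matrix.one_mul, Matrix.one_mul]
      abel
    rw [hM', hCS] at e
    simpa using e
  have hnorm : ‖N‖ ^ 2 = 0 := by
    have e := congrArg Matrix.trace horth
    rw [Matrix.trace_add, Matrix.trace_zero] at e
    rw [hG, Matrix.transpose_add, hCt, Matrix.add_mul, Matrix.mul_add, Matrix.mul_add,
      Matrix.trace_add, Matrix.trace_add, Matrix.trace_add] at htr1
    rw [norm_sq_eq_trace]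
    linarith
  simpa using hnorm

/-- An orthonormal family of vectors with indices in `s ⊆ {1, …, k}`, `k ≤ n`, extends to `k`
orthonormal vectors. -/
theorem exists_orthonormal_extension (hkn : k ≤ n) {x : Fin k → EuclideanSpace ℝ (Fin n)}
    {s : Set (Fin k)} (hx : ∀ i ∈ s, ∀ j ∈ s, ⟪x i, x j⟫ = if i = j then 1 else 0) :
    ∃ Δ : Matrix (Fin n) (Fin k) ℝ, Δᵀ * Δ = 1 ∧ ∀ i ∈ s, colVec Δ i = x i := by
  let y : Fin n → EuclideanSpace ℝ (Fin n) := fun j => if h : j.1 < k then x ⟨j, h⟩ else 0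
  have hy : ∀ i : Fin k, y (Fin.castLE hkn i) = x i := fun i => by simp [y]
  have ho : Orthonormal ℝ ((Fin.castLE hkn '' s).domRestrict y) := by
    classical
    rw [orthonormal_iff_ite]
    rintro ⟨_, i, hi, rfl⟩ ⟨_, j, hj, rfl⟩
    simp only [Set.domRestrict_apply, hy, hx i hi j hj]
    refine if_congr ⟨?_, fun h => Fin.castLE_injective hkn (congrArg Subtype.val h)⟩ rfl rfl
    rintro rfl
    rfl
  obtain ⟨b, hb⟩ := ho.exists_orthonormalBasis_extension_of_card_eq (by simp)
  refine ⟨Matrix.of fun r i => b (Fin.castLE hkn i) r, ?_, fun i hi => ?_⟩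
  · ext i j
    rw [← inner_colVec]
    change ⟪b (Fin.castLE hkn i), b (Fin.castLE hkn j)⟫ = _
    rw [b.inner_eq_ite, Matrix.one_apply]
    simp only [(Fin.castLE_injective hkn).eq_iff]
  · rw [← hy i]
    exact hb _ ⟨i, hi, rfl⟩

/-- For bases `A`, `B` adapted to the principal angles there is a `Δ` with
`B = A cos Θ + Δ sin Θ`: its `i`-th column is `(bᵢ - cos θᵢ aᵢ) / sin θᵢ` when `θᵢ ≠ 0`, and the
columns that belong to `θᵢ = 0` are chosen by extension. -/
theorem exists_eq_mul_cos_add_mul_sin {A B : Matrix (Fin n) (Fin k) ℝ} (hA : Aᵀ * A = 1)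
    (hB : Bᵀ * B = 1) (hAB : Aᵀ * B = Matrix.diagonal fun i => Real.cos (θ i))
    (hθ : ∀ i, θ i ∈ Icc 0 (Real.pi / 2)) :
    ∃ Δ : Matrix (Fin n) (Fin k) ℝ, Δᵀ * Δ = 1 ∧
      B = A * Matrix.diagonal (fun i => Real.cos (θ i)) +
        Δ * Matrix.diagonal (fun i => Real.sin (θ i)) := by
  have hkn : k ≤ n := by
    have h1 := Submodule.finrank_le (colSpan A)
    rwa [finrank_colSpan hA, finrank_euclideanSpace_fin] at h1
  have hcol : ∀ i j, ⟪colVec A i, colVec B j⟫ = if i = j then Real.cos (θ i) else 0 :=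
    fun i j => by rw [inner_colVec, hAB, Matrix.diagonal_apply]
  have hAA : ∀ i j, ⟪colVec A i, colVec A j⟫ = if i = j then 1 else 0 := fun i j => by
    rw [inner_colVec, hA, Matrix.one_apply]
  have hBB : ∀ i j, ⟪colVec B i, colVec B j⟫ = if i = j then 1 else 0 := fun i j => by
    rw [inner_colVec, hB, Matrix.one_apply]
  obtain ⟨Δ, hΔ, hΔx⟩ := exists_orthonormal_extension hkn (s := {i | Real.sin (θ i) ≠ 0})
    (x := fun i => (Real.sin (θ i))⁻¹ • (colVec B i - Real.cos (θ i) • colVec A i)) (by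
      intro i hi j hj
      have hBA : ⟪colVec B i, colVec A j⟫ = if i = j then Real.cos (θ i) else 0 := by
        rw [real_inner_comm, hcol]
        by_cases hij : i = j
        · simp [hij]
        · simp [hij, Ne.symm hij]
      simp only [inner_smul_left, inner_smul_right, inner_sub_left, inner_sub_right, hcol, hAA, hBB,
        hBA, conj_trivial]
      by_cases hij : i = j
      · subst hij
        have hs : Real.sin (θ i) ≠ 0 := hi
        simp only [if_true]
        field_simp
        linarith [Real.sin_sq_add_cos_sq (θ i)]
      · simp [hij])
  refine ⟨Δ, hΔ, eq_of_colVec_eq fun i => ?_⟩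
  have hsum : colVec (A * Matrix.diagonal (fun i => Real.cos (θ i)) +
        Δ * Matrix.diagonal (fun i => Real.sin (θ i))) i =
      Real.cos (θ i) • colVec A i + Real.sin (θ i) • colVec Δ i := by
    ext r
    simp [colVec, Matrix.mul_diagonal, mul_comm]
  rw [hsum]
  by_cases hs : Real.sin (θ i) = 0
  · have hpi := Real.pi_pos
    have h0 : θ i = 0 := by
      by_contra hne
      exact (Real.sin_pos_of_pos_of_lt_pi (lt_of_le_of_ne (hθ i).1 (Ne.symm hne))
        (by linarith [(hθ i).2])).ne' hs
    have h1 := hcol i i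
    rw [if_pos rfl, h0, Real.cos_zero] at h1
    rw [h0, Real.cos_zero, Real.sin_zero, one_smul, zero_smul, add_zero]
    exact ((inner_eq_one_iff_of_norm_eq_one (norm_colVec_eq_one hA i)
      (norm_colVec_eq_one hB i)).1 h1).symm
  · rw [hΔx i hs, smul_smul, mul_inv_cancel₀ hs, one_smul]
    abel

end PrincipalAngles

/-! ### The curve `γ` -/

section ModeCurve

variable {n k : ℕ} {M Δ : Matrix (Fin n) (Fin k) ℝ} {θ : Fin k → ℝ}

/-- The derivative of `modeCurve`. -/
noncomputable def modeVelocity (M Δ : Matrix (Fin n) (Fin k) ℝ) (θ : Fin k → ℝ) (t : ℝ) :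
    Matrix (Fin n) (Fin k) ℝ :=
  M * Matrix.diagonal (fun i => -Real.sin (t * θ i) * θ i) +
    Δ * Matrix.diagonal (fun i => Real.cos (t * θ i) * θ i)

theorem hasDerivAt_modeCurve (t : ℝ) :
    HasDerivAt (modeCurve M Δ θ) (modeVelocity M Δ θ t) t := by
  have hl : ∀ i, HasDerivAt (fun s : ℝ => s * θ i) (θ i) t := fun i => by
    simpa using (hasDerivAt_id t).mul_const (θ i)
  have h1 := (hasDerivAt_diagonal fun i => (hl i).cos).hasDerivWithinAt (s := univ)
  have h2 := (hasDerivAt_diagonal fun i => (hl i).sin).hasDerivWithinAt (s := univ)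
  refine hasDerivWithinAt_univ.1 ((((hasDerivWithinAt_const t univ M).matrixMul h1).add
    ((hasDerivWithinAt_const t univ Δ).matrixMul h2)).congr_deriv ?_)
  simp [modeVelocity]

/-- The curve satisfies `γ'' = - γ Θ²`. -/
theorem hasDerivAt_modeVelocity (t : ℝ) :
    HasDerivAt (modeVelocity M Δ θ)
      (-(modeCurve M Δ θ t * Matrix.diagonal fun i => θ i ^ 2)) t := by
  have hl : ∀ i, HasDerivAt (fun s : ℝ => s * θ i) (θ i) t := fun i => by
    simpa using (hasDerivAt_id t).mul_const (θ i)
  have h1 := (hasDerivAt_diagonal fun i => (hl i).sin.neg.mul_const (θ i)).hasDerivWithinAt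
    (s := univ)
  have h2 := (hasDerivAt_diagonal fun i => (hl i).cos.mul_const (θ i)).hasDerivWithinAt
    (s := univ)
  refine hasDerivWithinAt_univ.1 ((((hasDerivWithinAt_const t univ M).matrixMul h1).add
    ((hasDerivWithinAt_const t univ Δ).matrixMul h2)).congr_deriv ?_)
  ext r i
  simp only [modeCurve, Matrix.add_apply, Matrix.mul_diagonal, Matrix.neg_apply, Matrix.zero_mul,
    add_zero]
  ring

theorem contDiff_modeCurve {N : WithTop ℕ∞} : ContDiff ℝ N (modeCurve M Δ θ) := by
  let D : (Fin k → ℝ) →L[ℝ] Matrix (Fin k) (Fin k) ℝ := LinearMap.toContinuousLinearMap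
    (Matrix.diagonalLinearMap (Fin k) ℝ ℝ)
  have h1 : ContDiff ℝ N fun t : ℝ => Matrix.diagonal fun i => Real.cos (t * θ i) :=
    D.contDiff.comp (contDiff_pi.2 fun i => Real.contDiff_cos.comp (contDiff_id.mul contDiff_const))
  have h2 : ContDiff ℝ N fun t : ℝ => Matrix.diagonal fun i => Real.sin (t * θ i) :=
    D.contDiff.comp (contDiff_pi.2 fun i => Real.contDiff_sin.comp (contDiff_id.mul contDiff_const))
  exact ((matrixMulCLM _ _ _ M).contDiff.comp h1).add ((matrixMulCLM _ _ _ Δ).contDiff.comp h2)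

theorem modeCurve_zero : modeCurve M Δ θ 0 = M := by
  simp [modeCurve]

/-- Inner products of the columns of two combinations of `M` and `Δ`, when the columns of `Δ` that
enter are orthogonal to those of `M`. -/
theorem transpose_combination_mul_combination (hM : Mᵀ * M = 1) (hΔ : Δᵀ * Δ = 1)
    {f g p q : Fin k → ℝ} (hg : Mᵀ * Δ * Matrix.diagonal g = 0)
    (hq : Mᵀ * Δ * Matrix.diagonal q = 0) :
    (M * Matrix.diagonal f + Δ * Matrix.diagonal g)ᵀ *
      (M * Matrix.diagonal p + Δ * Matrix.diagonal q) =
      Matrix.diagonal fun i => f i * p i + g i * q i := by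
  have hg' : Matrix.diagonal g * (Δᵀ * M) = 0 := by
    have := congrArg Matrix.transpose hg
    simpa [Matrix.transpose_mul] using this
  simp only [Matrix.transpose_add, Matrix.transpose_mul, Matrix.diagonal_transpose, Matrix.add_mul,
    Matrix.mul_add]
  have e1 : Matrix.diagonal f * Mᵀ * (M * Matrix.diagonal p) =
      Matrix.diagonal fun i => f i * p i := by
    rw [Matrix.mul_assoc, ← Matrix.mul_assoc Mᵀ, hM, Matrix.one_mul, Matrix.diagonal_mul_diagonal]
  have e2 : Matrix.diagonal g * Δᵀ * (Δ * Matrix.diagonal q) =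
      Matrix.diagonal fun i => g i * q i := by
    rw [Matrix.mul_assoc, ← Matrix.mul_assoc Δᵀ, hΔ, Matrix.one_mul, Matrix.diagonal_mul_diagonal]
  have e3 : Matrix.diagonal f * Mᵀ * (Δ * Matrix.diagonal q) = 0 := by
    rw [Matrix.mul_assoc, ← Matrix.mul_assoc Mᵀ, hq, Matrix.mul_zero]
  have e4 : Matrix.diagonal g * Δᵀ * (M * Matrix.diagonal p) = 0 := by
    rw [← Matrix.mul_assoc, Matrix.mul_assoc _ Δᵀ, hg', Matrix.zero_mul]
  rw [e1, e2, e3, e4, zero_add, add_zero, Matrix.diagonal_add]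

/-- If `Mᵀ Δ sin Θ = 0`, then `Mᵀ Δ` has a zero column wherever `θᵢ ≠ 0`. -/
theorem mul_diagonal_eq_zero {A : Matrix (Fin k) (Fin k) ℝ} (hθ : ∀ i, θ i ∈ Icc 0 (Real.pi / 2))
    (h : A * Matrix.diagonal (fun i => Real.sin (θ i)) = 0)
    {g : Fin k → ℝ} (hg : ∀ i, θ i = 0 → g i = 0) : A * Matrix.diagonal g = 0 := by
  ext i j
  have h1 := congrFun (congrFun h i) j
  rw [Matrix.mul_diagonal, Matrix.zero_apply] at h1 ⊢
  rcases mul_eq_zero.1 h1 with h2 | h2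
  · rw [h2, zero_mul]
  · have h0 : θ j = 0 := by
      by_contra hne
      exact (Real.sin_pos_of_pos_of_lt_pi (lt_of_le_of_ne (hθ j).1 (Ne.symm hne))
        (by linarith [(hθ j).2, Real.pi_pos])).ne' h2
    rw [hg j h0, mul_zero]

variable (hθ : ∀ i, θ i ∈ Icc 0 (Real.pi / 2)) (hM : Mᵀ * M = 1) (hΔ : Δᵀ * Δ = 1)
  (hA : Mᵀ * Δ * Matrix.diagonal (fun i => Real.sin (θ i)) = 0)

include hθ hM hΔ hA

theorem modeCurve_transpose_mul_self (t : ℝ) :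
    (modeCurve M Δ θ t)ᵀ * modeCurve M Δ θ t = 1 := by
  have h := mul_diagonal_eq_zero hθ hA (g := fun i => Real.sin (t * θ i))
    fun i hi => by simp [hi]
  unfold modeCurve
  rw [transpose_combination_mul_combination hM hΔ h h, ← Matrix.diagonal_one]
  congr 1
  ext i
  linarith [Real.sin_sq_add_cos_sq (t * θ i)]

/-- The curve is horizontal: `γᵀ γ' = 0`. -/
theorem modeCurve_transpose_mul_modeVelocity (t : ℝ) :
    (modeCurve M Δ θ t)ᵀ * modeVelocity M Δ θ t = 0 := by
  have h1 := mul_diagonal_eq_zero hθ hA (g := fun i => Real.sin (t * θ i))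
    fun i hi => by simp [hi]
  have h2 := mul_diagonal_eq_zero hθ hA (g := fun i => Real.cos (t * θ i) * θ i)
    fun i hi => by simp [hi]
  unfold modeCurve modeVelocity
  rw [transpose_combination_mul_combination hM hΔ h1 h2, ← Matrix.diagonal_zero]
  congr 1
  ext i
  ring

theorem modeVelocity_transpose_mul_self (t : ℝ) :
    (modeVelocity M Δ θ t)ᵀ * modeVelocity M Δ θ t = Matrix.diagonal fun i => θ i ^ 2 := by
  have h2 := mul_diagonal_eq_zero hθ hA (g := fun i => Real.cos (t * θ i) * θ i)
    fun i hi => by simp [hi]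
  unfold modeVelocity
  rw [transpose_combination_mul_combination hM hΔ h2 h2]
  congr 1
  ext i
  linear_combination θ i ^ 2 * Real.sin_sq_add_cos_sq (t * θ i)

theorem norm_modeVelocity (t : ℝ) : ‖modeVelocity M Δ θ t‖ = Real.sqrt (∑ i, θ i ^ 2) := by
  rw [← Real.sqrt_sq (norm_nonneg (modeVelocity M Δ θ t)), norm_sq_eq_trace,
    modeVelocity_transpose_mul_self hθ hM hΔ hA, Matrix.trace_diagonal]

theorem projMatrix_modeCurve (t : ℝ) : projMatrix (colSpan (modeCurve M Δ θ t)) =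
    modeCurve M Δ θ t * (modeCurve M Δ θ t)ᵀ :=
  projMatrix_colSpan (modeCurve_transpose_mul_self hθ hM hΔ hA t)

theorem isGrCurve_modeCurve (r : ℕ) : IsGrCurve k r fun t => colSpan (modeCurve M Δ θ t) := by
  refine ⟨fun t _ => finrank_colSpan (modeCurve_transpose_mul_self hθ hM hΔ hA t), ?_⟩
  simp only [projMatrix_modeCurve hθ hM hΔ hA]
  exact (((matrixMulCLM _ _ _).contDiff.comp contDiff_modeCurve).clm_apply
    ((matrixTransposeCLM _ _).contDiff.comp contDiff_modeCurve)).contDiffOn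

theorem grVelocity_modeCurve {t : ℝ} (ht : t ∈ Icc (0 : ℝ) 1) :
    grVelocity (fun t => colSpan (modeCurve M Δ θ t)) t =
      modeCurve M Δ θ t * (modeVelocity M Δ θ t)ᵀ +
        modeVelocity M Δ θ t * (modeCurve M Δ θ t)ᵀ := by
  unfold grVelocity
  simp only [projMatrix_modeCurve hθ hM hΔ hA]
  have h := (hasDerivAt_modeCurve (M := M) (Δ := Δ) (θ := θ) t).hasDerivWithinAt (s := Icc 0 1)
  exact (h.matrixMul h.matrixTranspose).derivWithin (uniqueDiffOn_Icc_zero_one t ht)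

theorem derivWithin_grVelocity_modeCurve {t : ℝ} (ht : t ∈ Icc (0 : ℝ) 1) :
    derivWithin (grVelocity fun t => colSpan (modeCurve M Δ θ t)) (Icc 0 1) t =
      (2 : ℝ) • (modeVelocity M Δ θ t * (modeVelocity M Δ θ t)ᵀ -
        modeCurve M Δ θ t * Matrix.diagonal (fun i => θ i ^ 2) * (modeCurve M Δ θ t)ᵀ) := by
  have h := (hasDerivAt_modeCurve (M := M) (Δ := Δ) (θ := θ) t).hasDerivWithinAt (s := Icc 0 1)
  have h' := (hasDerivAt_modeVelocity (M := M) (Δ := Δ) (θ := θ) t).hasDerivWithinAt (s := Icc 0 1)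
  refine (derivWithin_congr (fun s hs => grVelocity_modeCurve hθ hM hΔ hA hs)
    (grVelocity_modeCurve hθ hM hΔ hA ht)).trans
    ((((h.matrixMul h'.matrixTranspose).add (h'.matrixMul h.matrixTranspose)).derivWithin
      (uniqueDiffOn_Icc_zero_one t ht)).trans ?_)
  simp only [Matrix.transpose_neg, Matrix.transpose_mul, Matrix.diagonal_transpose, Matrix.mul_neg,
    Matrix.neg_mul, Matrix.mul_assoc]
  module

/-- The acceleration `2 (γ' γ'ᵀ - γ Θ² γᵀ)` of the curve of projections `P = γ γᵀ` is orthogonal to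
the tangent vectors `X = P X + X P`, since `γᵀ X γ = 0` and `γ'ᵀ X γ' = 0`. -/
theorem isGrGeodesic_modeCurve : IsGrGeodesic k fun t => colSpan (modeCurve M Δ θ t) := by
  refine ⟨isGrCurve_modeCurve hθ hM hΔ hA 2, fun t ht X hX => ?_⟩
  obtain ⟨-, hX⟩ := hX
  rw [projMatrix_modeCurve hθ hM hΔ hA] at hX
  have hgg := modeCurve_transpose_mul_self hθ hM hΔ hA t
  have hgv := modeCurve_transpose_mul_modeVelocity hθ hM hΔ hA t
  rw [derivWithin_grVelocity_modeCurve hθ hM hΔ hA ht]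
  set g := modeCurve M Δ θ t
  set v := modeVelocity M Δ θ t
  set D : Matrix (Fin k) (Fin k) ℝ := Matrix.diagonal fun i => θ i ^ 2 with hD
  have hvg : vᵀ * g = 0 := by
    have := congrArg Matrix.transpose hgv
    simpa [Matrix.transpose_mul] using this
  have h1 : gᵀ * X * g = 0 := by
    have e : gᵀ * X * g = gᵀ * (g * gᵀ * X + X * (g * gᵀ)) * g := by rw [hX]
    have e2 : gᵀ * (g * gᵀ * X + X * (g * gᵀ)) * g = gᵀ * X * g + gᵀ * X * g := by
      rw [Matrix.mul_add, Matrix.add_mul, Matrix.mul_assoc g, ← Matrix.mul_assoc gᵀ g, hgg,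
        Matrix.one_mul]
      congr 1
      simp only [Matrix.mul_assoc, hgg, Matrix.mul_one]
    rw [e2] at e
    simpa using e
  have h2 : vᵀ * X * v = 0 := by
    have e : vᵀ * X * v = vᵀ * (g * gᵀ * X + X * (g * gᵀ)) * v := by rw [hX]
    rw [e, Matrix.mul_add, Matrix.add_mul, Matrix.mul_assoc g, ← Matrix.mul_assoc vᵀ g, hvg]
    simp only [Matrix.mul_assoc, hgv, Matrix.mul_zero, Matrix.zero_mul, add_zero]
  have h3 : (v * vᵀ * X).trace = 0 := by
    rw [Matrix.mul_assoc, Matrix.trace_mul_comm, h2, Matrix.trace_zero]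
  have h4 : (g * D * gᵀ * X).trace = 0 := by
    rw [Matrix.mul_assoc, Matrix.trace_mul_comm, ← Matrix.mul_assoc, h1, Matrix.zero_mul,
      Matrix.trace_zero]
  unfold grMetric
  rw [Matrix.transpose_smul, Matrix.transpose_sub, Matrix.transpose_mul, Matrix.transpose_mul,
    Matrix.transpose_mul, Matrix.transpose_transpose, Matrix.transpose_transpose, hD,
    Matrix.diagonal_transpose, ← hD, ← Matrix.mul_assoc, Matrix.smul_mul, Matrix.sub_mul,
    Matrix.trace_smul, Matrix.trace_sub, h3, h4]
  simp

theorem grLength_modeCurve :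
    grLength (fun t => colSpan (modeCurve M Δ θ t)) = Real.sqrt (∑ i, θ i ^ 2) := by
  have hspeed : ∀ t ∈ Icc (0 : ℝ) 1,
      grMetric (grVelocity (fun t => colSpan (modeCurve M Δ θ t)) t)
        (grVelocity (fun t => colSpan (modeCurve M Δ θ t)) t) = ∑ i, θ i ^ 2 := by
    intro t ht
    have hgg := modeCurve_transpose_mul_self hθ hM hΔ hA t
    have hgv := modeCurve_transpose_mul_modeVelocity hθ hM hΔ hA t
    have hvv := modeVelocity_transpose_mul_self hθ hM hΔ hA t
    rw [grVelocity_modeCurve hθ hM hΔ hA ht]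
    set g := modeCurve M Δ θ t
    set v := modeVelocity M Δ θ t
    have hvg : vᵀ * g = 0 := by
      have := congrArg Matrix.transpose hgv
      simpa [Matrix.transpose_mul] using this
    have e : (g * vᵀ + v * gᵀ)ᵀ * (g * vᵀ + v * gᵀ) = v * vᵀ + g * (vᵀ * v) * gᵀ := by
      simp only [Matrix.transpose_add, Matrix.transpose_mul, Matrix.transpose_transpose,
        Matrix.add_mul, Matrix.mul_add, Matrix.mul_assoc]
      rw [← Matrix.mul_assoc gᵀ g, ← Matrix.mul_assoc gᵀ v, ← Matrix.mul_assoc vᵀ g, hgg, hgv, hvg]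
      simp
    unfold grMetric
    rw [e, Matrix.trace_add, Matrix.trace_mul_comm, Matrix.trace_mul_comm (g * (vᵀ * v)),
      ← Matrix.mul_assoc, hgg, Matrix.one_mul, hvv, Matrix.trace_diagonal]
    ring
  unfold grLength
  rw [intervalIntegral.integral_congr (g := fun _ => Real.sqrt (∑ i, θ i ^ 2))]
  · simp
  · intro t ht
    rw [uIcc_of_le zero_le_one] at ht
    simp only [hspeed t ht]

end ModeCurve

/-! ### Shortest geodesics between two subspaces -/

theorem theorem1 (n k : ℕ) (M M' : Matrix (Fin n) (Fin k) ℝ)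
    (hM : Mᵀ * M = 1) (hM' : M'ᵀ * M' = 1)
    (θ : Fin k → ℝ) (hθ : IsPrincipalAngles (colSpan M) (colSpan M') θ) :
    -- the two subspaces have orthonormal bases `M * U`, `M' * V` and a `Δ` as in the hypothesis below
    (∃ U V : Matrix (Fin k) (Fin k) ℝ, ∃ Δ : Matrix (Fin n) (Fin k) ℝ,
      Uᵀ * U = 1 ∧ Vᵀ * V = 1 ∧ Δᵀ * Δ = 1 ∧
      M' * V = M * U * Matrix.diagonal (fun i => Real.cos (θ i)) +
        Δ * Matrix.diagonal (fun i => Real.sin (θ i))) ∧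
    ∀ Δ : Matrix (Fin n) (Fin k) ℝ, Δᵀ * Δ = 1 →
      M' = M * Matrix.diagonal (fun i => Real.cos (θ i)) +
        Δ * Matrix.diagonal (fun i => Real.sin (θ i)) →
      -- `γ` is a curve of orthonormal bases from `M` to `M'`
      (∀ t ∈ Icc (0 : ℝ) 1, (modeCurve M Δ θ t)ᵀ * modeCurve M Δ θ t = 1) ∧
      modeCurve M Δ θ 0 = M ∧ modeCurve M Δ θ 1 = M' ∧
      -- it is a shortest geodesic on the Grassmannian
      IsShortestGrGeodesic k (colSpan M) (colSpan M') (fun t => colSpan (modeCurve M Δ θ t)) ∧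
      -- the only one, if all principal angles are less than `π / 2`
      ((∀ i, θ i < Real.pi / 2) → ∀ c : ℝ → Submodule ℝ (EuclideanSpace ℝ (Fin n)),
        IsShortestGrGeodesic k (colSpan M) (colSpan M') c →
          ∀ t ∈ Icc (0 : ℝ) 1, c t = colSpan (modeCurve M Δ θ t)) ∧
      -- its length, also as the integral of the Frobenius norm of the derivative of `γ`
      grLength (fun t => colSpan (modeCurve M Δ θ t)) = Real.sqrt (∑ i, θ i ^ 2) ∧
      ∫ t in (0 : ℝ)..1, ‖deriv (modeCurve M Δ θ) t‖ = Real.sqrt (∑ i, θ i ^ 2) := by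
  have hI := hθ.2.1
  refine ⟨?_, fun Δ hΔ h => ?_⟩
  · obtain ⟨U, V, hU, hV, hUV⟩ := hθ.exists_adapted hM hM'
    have horth : ∀ {A : Matrix (Fin n) (Fin k) ℝ} {B : Matrix (Fin k) (Fin k) ℝ},
        Aᵀ * A = 1 → Bᵀ * B = 1 → (A * B)ᵀ * (A * B) = 1 := fun {A B} h1 h2 => by
      rw [Matrix.transpose_mul, Matrix.mul_assoc, ← Matrix.mul_assoc Aᵀ, h1, Matrix.one_mul, h2]
    obtain ⟨Δ, hΔ, h⟩ := exists_eq_mul_cos_add_mul_sin (horth hM hU) (horth hM' hV) hUV hI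
    exact ⟨U, V, Δ, hU, hV, hΔ, h⟩
  · have hA := transpose_mul_mul_diagonal_sin hM hM' hΔ hθ h
    have hC : Mᵀ * M' = Matrix.diagonal fun i => Real.cos (θ i) := by
      rw [h, Matrix.mul_add, ← Matrix.mul_assoc, ← Matrix.mul_assoc, hM, hA, Matrix.one_mul,
        add_zero]
    have h0 : modeCurve M Δ θ 0 = M := modeCurve_zero
    have h1 : modeCurve M Δ θ 1 = M' := by simp [modeCurve, ← h]
    have hlen := grLength_modeCurve hI hM hΔ hA
    have hgeo := isGrGeodesic_modeCurve hI hM hΔ hA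
    have hshort : IsShortestGrGeodesic k (colSpan M) (colSpan M')
        (fun t => colSpan (modeCurve M Δ θ t)) :=
      ⟨hgeo, by simp only [h0], by simp only [h1], fun d hd hd0 hd1 =>
        hlen.trans_le (hd.sqrt_sum_sq_le_grLength hI hM hM' hC hd0 hd1)⟩
    refine ⟨fun t _ => modeCurve_transpose_mul_self hI hM hΔ hA t, h0, h1, hshort, ?_, hlen, ?_⟩
    · rintro hlt c ⟨hc, hc0, hc1, hmin⟩
      exact hc.eq_of_grLength_le hgeo hI hlt hM hM' hC hc0 hc1 hshort.2.1 hshort.2.2.1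
        ((hmin _ (isGrCurve_modeCurve hI hM hΔ hA 1) hshort.2.1 hshort.2.2.1).trans_eq hlen) hlen.le
    · have hnorm : ∀ t, ‖deriv (modeCurve M Δ θ) t‖ = Real.sqrt (∑ i, θ i ^ 2) := fun t =>
        (congrArg norm (hasDerivAt_modeCurve t).deriv).trans (norm_modeVelocity hI hM hΔ hA t)
      simp only [hnorm]
      simp
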